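/- Throughout, ${}_2F_1(a,b;c;z)$ denotes the Gauss hypergeometric function on $\mathbb{C}\setminus[1,\infty)$, i.e. the analytic continuation of the Gauss series from the unit disc, $\mathbb{R}_+=(0,\infty)$, and all $L^2$ functions may be complex-valued. Let $\lambda>-\frac1\pi$ and $\mu>0$ be real. Put $$\alpha_\lambda=\frac{\arcsin(\lambda\pi)}{\pi}\ \text{ for } |\lambda|\le\tfrac1\pi,\qquad \alpha_\lambda=\frac12+\mathrm{i}\,\frac{\operatorname{arcosh}(\lambda\pi)}{\pi}\ \text{ for } \lambda\ge\tfrac1\pi,$$ $$c_\lambda=\frac{\lambda}{\alpha_\lambda(1-\alpha_\lambda)}\ \text{ for }\lambda\ne0,\qquad c_0=1,$$ and, for $x\ge 0$, $$J(x)=x\;{}_2F_1\Big(\alpha_\lambda,1-\alpha_\lambda;2;-\frac{x}{\mu^2}\Big),\qquad \phi(x)={}_2F_1(1+\alpha_\lambda,2-\alpha_\lambda;2;-x).$$ Then: 1. $\sin(\alpha_\lambda\pi)=\lambda\pi$, the number $c_\lambda$ is real, and $J$ and $\phi$ are real-valued on $[0,\infty)$. 2. For every $x\ge0$ the following integral converges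 absolutely and $$J(x)=x-\lambda x^2\int_0^\infty \frac{J(t)}{(t+\mu^2)^2(t+\mu^2+x)}\,dt. \tag{Fred}$$ 3. Equivalently, after the rescaling $J(x)=x\big(1+\frac{x}{\mu^2}\big)\,\phi\big(\frac{x}{\mu^2}\big)$ ($x\ge0$), $\phi$ satisfies, for every $x\ge0$ and with an absolutely convergent integral, $$\phi(x)=\frac{c_\lambda}{1+x}-\lambda\int_0^\infty\frac{\phi(t)}{1+t+x}\,dt,\qquad \phi(0)=1. \tag{feq}$$ 4. The solutions are unique in $L^2(\mathbb{R}_+)$, in the following sense. The functions $\frac{J(x)}{x(\mu^2+x)}$ and $\phi$ belong to $L^2(\mathbb{R}_+)$. If $K$ is a function such that $\frac{K(x)}{x(\mu^2+x)}$ lies in $L^2(\mathbb{R}_+)$ and $K$ satisfies (Fred) for almost every $x>0$, then $K=J$ almost everywhere on $\mathbb{R}_+$. If $\psi\in L^2(\mathbb{R}_+)$ satisfies the integral equation in (feq), with the constant $c_\lambda$, for almost every $x>0$, then $\psi=\phi$ almost everywhere on $\mathbb{R}_+$. Finally, if $c\in\mathbb{C}$ and $\psi:[0,\infty)\to\mathbb{C}$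 is square-integrable on $\mathbb{R}_+$, has $\psi(0)=1$, and satisfies $\psi(x)=\frac{c}{1+x}-\lambda\int_0^\infty\frac{\psi(t)}{1+t+x}\,dt$ for every $x\ge0$ with absolutely convergent integrals, then $c=c_\lambda$ and $\psi=\phi$ on $[0,\infty)$. -/

import Mathlib

open MeasureTheory

noncomputable section

namespace SelfDualPhi4

/-- The plane cut along `[1, ∞)`. -/
def cutPlane : Set ℂ := {z | 1 - z ∈ Complex.slitPlane}

/-- `F` is holomorphic on `ℂ ∖ [1, ∞)` and is given on the open unit disc by the Gauss series
`∑ (a)_n (b)_n / ((c)_n n!) z ^ n`. -/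
def IsGaussContinuation (a b c : ℂ) (F : ℂ → ℂ) : Prop :=
  DifferentiableOn ℂ F cutPlane ∧ ∀ z ∈ Metric.ball (0 : ℂ) 1, F z = ordinaryHypergeometric a b c z

open Classical in
/-- The Gauss hypergeometric function `₂F₁(a, b; c; z)` on `ℂ ∖ [1, ∞)` (principal branch), i.e. the
analytic continuation of the Gauss series. The series alone is not enough, as Mathlib's
`ordinaryHypergeometric` carries no information outside the disc of convergence. -/
def hyp2F1 (a b c : ℂ) : ℂ → ℂ :=
  if h : ∃ F : ℂ → ℂ, IsGaussContinuation a b c F then h.choose else 0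

theorem isOpen_cutPlane : IsOpen cutPlane :=
  Complex.isOpen_slitPlane.preimage (continuous_const.sub continuous_id)

theorem zero_mem_cutPlane : (0 : ℂ) ∈ cutPlane := by
  simp [cutPlane]

theorem isPreconnected_cutPlane : IsPreconnected cutPlane := by
  have h : cutPlane = (fun w : ℂ => 1 - w) '' Complex.slitPlane := by
    ext z
    constructor
    · intro hz
      exact ⟨1 - z, hz, by simp⟩
    · rintro ⟨w, hw, rfl⟩
      simpa [cutPlane] using hw
  rw [h]
  have hs : IsPreconnected Complex.slitPlane :=
    (Complex.starConvex_one_slitPlane.isPathConnected Complex.one_mem_slitPlane).isConnected.isPreconnected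
  exact hs.image _ (continuous_const.sub continuous_id).continuousOn

/-- The continuation is unique, so `hyp2F1` does not depend on the choice made in its definition. -/
theorem IsGaussContinuation.eqOn_hyp2F1 {a b c : ℂ} {F : ℂ → ℂ} (hF : IsGaussContinuation a b c F) :
    Set.EqOn F (hyp2F1 a b c) cutPlane := by
  have h : ∃ F : ℂ → ℂ, IsGaussContinuation a b c F := ⟨F, hF⟩
  have hG : IsGaussContinuation a b c (hyp2F1 a b c) := by
    rw [hyp2F1, dif_pos h]
    exact h.choose_spec
  refine AnalyticOnNhd.eqOn_of_preconnected_of_eventuallyEq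
    (hF.1.analyticOnNhd isOpen_cutPlane) (hG.1.analyticOnNhd isOpen_cutPlane)
    isPreconnected_cutPlane zero_mem_cutPlane ?_
  filter_upwards [Metric.ball_mem_nhds (0 : ℂ) one_pos] with z hz
  rw [hF.2 z hz, hG.2 z hz]

/-- `α_λ = arcsin(λπ)/π` for `|λ| ≤ 1/π` and `α_λ = 1/2 + i arcosh(λπ)/π` for `λ ≥ 1/π`; the two
expressions agree at `λ = 1/π`. -/
def alphaParam (lam : ℝ) : ℂ :=
  if lam ≤ 1 / Real.pi then ((Real.arcsin (lam * Real.pi) / Real.pi : ℝ) : ℂ)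
  else 1 / 2 + Complex.I * ((Real.arcosh (lam * Real.pi) / Real.pi : ℝ) : ℂ)

theorem alphaParam_of_ge {lam : ℝ} (h : 1 / Real.pi ≤ lam) :
    alphaParam lam = 1 / 2 + Complex.I * ((Real.arcosh (lam * Real.pi) / Real.pi : ℝ) : ℂ) := by
  rcases h.eq_or_lt with rfl | h
  · have h1 : (1 / Real.pi) * Real.pi = 1 := by field_simp
    have h2 : Real.pi / 2 / Real.pi = 1 / 2 := by field_simp
    simp [alphaParam, h2]
  · rw [alphaParam, if_neg (not_le.mpr h)]

/-- `c_λ = λ/(α_λ(1 - α_λ))`, continued by its limit `1` to `λ = 0`, where `α_λ = 0`. -/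
def cParam (lam : ℝ) : ℂ :=
  if lam = 0 then 1 else (lam : ℂ) / (alphaParam lam * (1 - alphaParam lam))

/-- `J(x) = x ₂F₁(α_λ, 1 - α_λ; 2; -x/μ²)`. -/
def solJ (lam mu : ℝ) (x : ℝ) : ℂ :=
  (x : ℂ) * hyp2F1 (alphaParam lam) (1 - alphaParam lam) 2 ((-(x / mu ^ 2) : ℝ) : ℂ)

/-- `φ(x) = ₂F₁(1 + α_λ, 2 - α_λ; 2; -x)`. -/
def solPhi (lam : ℝ) (x : ℝ) : ℂ :=
  hyp2F1 (1 + alphaParam lam) (2 - alphaParam lam) 2 ((-x : ℝ) : ℂ)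

/-- Lebesgue measure on `ℝ₊ = (0, ∞)`. -/
def volPos : Measure ℝ := volume.restrict (Set.Ioi 0)

/-- The integrand of the Fredholm equation for `J`. -/
def fredIntegrand (mu : ℝ) (J : ℝ → ℂ) (x t : ℝ) : ℂ :=
  J t / (((t + mu ^ 2) ^ 2 * (t + mu ^ 2 + x) : ℝ) : ℂ)

/-- The right-hand side `x - λ x² ∫₀^∞ J(t) / ((t + μ²)² (t + μ² + x)) dt`. -/
def fredRHS (lam mu : ℝ) (J : ℝ → ℂ) (x : ℝ) : ℂ :=
  (x : ℂ) - (lam : ℂ) * (x : ℂ) ^ 2 * ∫ t, fredIntegrand mu J x t ∂volPos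

/-- The integrand of the rescaled equation for `φ`. -/
def rescaledIntegrand (phi : ℝ → ℂ) (x t : ℝ) : ℂ :=
  phi t / ((1 + t + x : ℝ) : ℂ)

/-- The right-hand side `c / (1 + x) - λ ∫₀^∞ φ(t) / (1 + t + x) dt`. -/
def rescaledRHS (lam : ℝ) (c : ℂ) (phi : ℝ → ℂ) (x : ℝ) : ℂ :=
  c / ((1 + x : ℝ) : ℂ) - (lam : ℂ) * ∫ t, rescaledIntegrand phi x t ∂volPos

/-- `J` solves the Fredholm equation at every `x ≥ 0`, with absolutely convergent integrals. -/
def SolvesFredholm (lam mu : ℝ) (J : ℝ → ℂ) : Prop :=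
  ∀ x : ℝ, 0 ≤ x → Integrable (fredIntegrand mu J x) volPos ∧ J x = fredRHS lam mu J x

/-- `φ` solves the rescaled equation with constant `c` at every `x ≥ 0`, with absolutely convergent
integrals, and is normalised by `φ(0) = 1`. -/
def SolvesRescaled (lam : ℝ) (c : ℂ) (phi : ℝ → ℂ) : Prop :=
  (∀ x : ℝ, 0 ≤ x → Integrable (rescaledIntegrand phi x) volPos ∧ phi x = rescaledRHS lam c phi x) ∧
    phi 0 = 1

/-- The rescaling `ρ(x) = J(x) / (x (μ² + x))`, which is the unknown for which the equation is posed
in `L²(ℝ₊)`. -/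
def symmetrised (mu : ℝ) (J : ℝ → ℂ) (x : ℝ) : ℂ :=
  J x / ((x * (mu ^ 2 + x) : ℝ) : ℂ)

end SelfDualPhi4

end

/-!
Let `aₙ` be the Taylor coefficients of `z ↦ φ(-z)`, let `mₙ = ∫₀^∞ φ(t) (1 + t)⁻ⁿ⁻¹ dt` be those of
`z ↦ ∫₀^∞ φ(t) / (1 + t - z) dt`, and put `κ = α(1 - α)`. The Gauss series gives
`(n + 1)(n + 2) aₙ₊₁ = ((n + 1)(n + 2) + κ) aₙ`, while the differential equation
`(t (1 + t) φ)'' = -κ φ` and two integrations by parts give the same recurrence for `mₙ` up to the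
inhomogeneity `-1`. Moreover `mₙ → 0`, and `aₙ → c = 1 / (Γ(1 + α) Γ(2 - α))`, where
`c κ = sin(πα) / π` by the reflection formula. Hence `aₙ + c κ mₙ - c` solves the homogeneous
recurrence and is a multiple of `aₙ`, and letting `n → ∞` shows that the multiple is zero. Summing
against `zⁿ` and continuing analytically gives the rescaled equation with `c κ = λ`, and
`J(x) = x (1 + x / μ²) φ(x / μ²)` then solves the Fredholm equation.

Uniqueness holds because the quadratic form `Q` of the Hilbert kernel `1 / (m + x + t)` satisfies
`0 ≤ Q ≤ π ‖·‖²`: it is positive since the kernel is a superposition of exponentials, and bounded by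
Schur's test with the weight `x ^ (-1/2)`. Reality follows from uniqueness, as the complex conjugate
of a solution is again a solution.
-/

noncomputable section

namespace SelfDualPhi4

open Filter Topology
open scoped ComplexConjugate

/-! ### Coefficients of the Gauss series -/

theorem ascPochhammer_eval_succ_left {R : Type*} [CommSemiring R] (a : R) (n : ℕ) :
    (ascPochhammer R (n + 1)).eval a = a * (ascPochhammer R n).eval (a + 1) := by
  simp [ascPochhammer_succ_left]

theorem succ_mul_ordinaryHypergeometricCoefficient_succ (a b : ℂ) {c : ℂ} {n : ℕ}
    (hc : c + n ≠ 0) :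
    ((n : ℂ) + 1) * (c + n) * ordinaryHypergeometricCoefficient a b c (n + 1) =
      (a + n) * (b + n) * ordinaryHypergeometricCoefficient a b c n := by
  have hn : (n : ℂ) + 1 ≠ 0 := n.cast_add_one_ne_zero
  simp only [ordinaryHypergeometricCoefficient, ascPochhammer_succ_eval, Nat.factorial_succ,
    mul_inv, Nat.cast_mul, Nat.cast_add_one]
  field_simp

theorem succ_mul_ordinaryHypergeometricCoefficient_succ_eq_shift (a b : ℂ) {c : ℂ} {n : ℕ}
    (hc : c + n ≠ 0) :
    ((n : ℂ) + 1) * (c + n) * ordinaryHypergeometricCoefficient a b c (n + 1) =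
      a * b * ordinaryHypergeometricCoefficient (a + 1) (b + 1) c n := by
  have hn : (n : ℂ) + 1 ≠ 0 := n.cast_add_one_ne_zero
  simp only [ordinaryHypergeometricCoefficient, ascPochhammer_eval_succ_left a,
    ascPochhammer_eval_succ_left b, ascPochhammer_succ_eval n c, Nat.factorial_succ, mul_inv,
    Nat.cast_mul, Nat.cast_add_one]
  field_simp

theorem ordinaryHypergeometricCoefficient_succ_eq_sub (a b : ℂ) {n : ℕ} (hc : a + b + 1 + n ≠ 0) :
    ordinaryHypergeometricCoefficient a b (a + b + 1) (n + 1) =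
      ordinaryHypergeometricCoefficient (a + 1) (b + 1) (a + b + 1) (n + 1) -
        ordinaryHypergeometricCoefficient (a + 1) (b + 1) (a + b + 1) n := by
  refine mul_left_cancel₀ (mul_ne_zero (n.cast_add_one_ne_zero (R := ℂ)) hc) ?_
  linear_combination succ_mul_ordinaryHypergeometricCoefficient_succ_eq_shift a b hc -
    succ_mul_ordinaryHypergeometricCoefficient_succ (a + 1) (b + 1) hc

theorem ascPochhammer_eval_eq_prod_range {R : Type*} [CommSemiring R] (s : R) (n : ℕ) :
    (ascPochhammer R n).eval s = ∏ j ∈ Finset.range n, (s + j) := by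
  induction n with
  | zero => simp
  | succ n ih => rw [ascPochhammer_succ_eval, ih, Finset.prod_range_succ]

theorem tendsto_ordinaryHypergeometricCoefficient {a b c : ℂ} (ha : ∀ m : ℕ, a ≠ -m)
    (hb : ∀ m : ℕ, b ≠ -m) (habc : a + b = c + 1) :
    Tendsto (ordinaryHypergeometricCoefficient a b c) atTop
      (𝓝 (Complex.Gamma c / (Complex.Gamma a * Complex.Gamma b))) := by
  rw [← tendsto_add_atTop_iff_nat 1]
  have hfrac : Tendsto (fun n : ℕ => (n : ℂ) / (n + 1)) atTop (𝓝 1) :=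
    tendsto_natCast_div_add_atTop 1
  have hGamma := hfrac.mul ((Complex.GammaSeq_tendsto_Gamma c).div
    ((Complex.GammaSeq_tendsto_Gamma a).mul (Complex.GammaSeq_tendsto_Gamma b))
    (mul_ne_zero (Complex.Gamma_ne_zero ha) (Complex.Gamma_ne_zero hb)))
  rw [one_mul] at hGamma
  refine hGamma.congr' ?_
  filter_upwards [eventually_ne_atTop 0] with n hn
  have hn0 : (n : ℂ) ≠ 0 := Nat.cast_ne_zero.mpr hn
  have hn1 : (n : ℂ) + 1 ≠ 0 := n.cast_add_one_ne_zero
  have hpow_a : (n : ℂ) ^ a ≠ 0 := by simp [Complex.cpow_eq_zero_iff, hn]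
  have hpow_b : (n : ℂ) ^ b ≠ 0 := by simp [Complex.cpow_eq_zero_iff, hn]
  have hpow_c : (n : ℂ) ^ c = (n : ℂ) ^ a * (n : ℂ) ^ b / n := by
    rw [← Complex.cpow_add _ _ hn0, habc, Complex.cpow_add _ _ hn0, Complex.cpow_one,
      mul_div_cancel_right₀ _ hn0]
  have hfact : (n.factorial : ℂ) ≠ 0 := Nat.cast_ne_zero.mpr n.factorial_ne_zero
  simp only [Pi.div_apply, Complex.GammaSeq, ← ascPochhammer_eval_eq_prod_range,
    ordinaryHypergeometricCoefficient, Nat.factorial_succ, Nat.cast_mul, Nat.cast_add_one]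
  rw [hpow_c]
  field_simp

/-! ### Continuation of the Gauss series -/

theorem ball_subset_cutPlane : Metric.ball (0 : ℂ) 1 ⊆ cutPlane := fun z hz => by
  simpa [cutPlane, sub_eq_add_neg] using
    Complex.mem_slitPlane_of_norm_lt_one (z := -z) (by simpa using hz)

theorem neg_mem_cutPlane {z : ℂ} (hz : -1 < z.re) : -z ∈ cutPlane := by
  refine Complex.mem_slitPlane_iff.mpr (Or.inl ?_)
  simp only [sub_neg_eq_add, Complex.add_re, Complex.one_re]
  linarith

theorem neg_ofReal_mem_cutPlane {x : ℝ} (hx : 0 ≤ x) : -(x : ℂ) ∈ cutPlane :=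
  neg_mem_cutPlane (by rw [Complex.ofReal_re]; linarith)

theorem one_le_radius_ordinaryHypergeometricSeries (a b c : ℂ) :
    1 ≤ (ordinaryHypergeometricSeries ℂ a b c).radius := by
  by_cases h : ∀ k : ℕ, (k : ℂ) ≠ -a ∧ (k : ℂ) ≠ -b ∧ (k : ℂ) ≠ -c
  · exact (ordinaryHypergeometricSeries_radius_eq_one ℂ a b c h).ge
  · suffices (ordinaryHypergeometricSeries ℂ a b c).radius = ⊤ from this ▸ le_top
    simp only [not_forall, not_and_or, not_not, eq_neg_iff_add_eq_zero, add_comm (_ : ℂ)] at h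
    obtain ⟨k, h | h | h⟩ := h <;> obtain rfl := eq_neg_of_add_eq_zero_left h
    · exact ordinaryHypergeometric_radius_top_of_neg_nat₁ ℂ b c
    · exact ordinaryHypergeometric_radius_top_of_neg_nat₂ ℂ a c
    · exact ordinaryHypergeometric_radius_top_of_neg_nat₃ ℂ a b

theorem hasSum_ordinaryHypergeometric (a b c : ℂ) {z : ℂ} (hz : ‖z‖ < 1) :
    HasSum (fun n => ordinaryHypergeometricCoefficient a b c n * z ^ n)
      (ordinaryHypergeometric a b c z) := by
  have hz' : z ∈ Metric.eball (0 : ℂ) (ordinaryHypergeometricSeries ℂ a b c).radius := by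
    refine Metric.eball_subset_eball (one_le_radius_ordinaryHypergeometricSeries a b c) ?_
    simpa [enorm_eq_nnnorm, ← NNReal.coe_lt_one] using hz
  have h := (ordinaryHypergeometricSeries ℂ a b c).hasSum hz'
  simp only [ordinaryHypergeometricSeries_apply_eq, smul_eq_mul] at h
  exact h

theorem isGaussContinuation_of_hasSum {a b c : ℂ} {F : ℂ → ℂ}
    (hF : DifferentiableOn ℂ F cutPlane)
    (hsum : ∀ z : ℂ, ‖z‖ < 1 →
      HasSum (fun n => ordinaryHypergeometricCoefficient a b c n * z ^ n) (F z)) :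
    IsGaussContinuation a b c F :=
  ⟨hF, fun z hz => have hz' : ‖z‖ < 1 := by simpa using hz
    (hsum z hz').unique (hasSum_ordinaryHypergeometric a b c hz')⟩

namespace IsGaussContinuation

variable {a b c : ℂ} {F : ℂ → ℂ}

theorem differentiableOn (hF : IsGaussContinuation a b c F) : DifferentiableOn ℂ F cutPlane :=
  hF.1

theorem hasSum (hF : IsGaussContinuation a b c F) {z : ℂ} (hz : ‖z‖ < 1) :
    HasSum (fun n => ordinaryHypergeometricCoefficient a b c n * z ^ n) (F z) := by
  rw [hF.2 z (by simpa using hz)]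
  exact hasSum_ordinaryHypergeometric a b c hz

theorem apply_zero (hF : IsGaussContinuation a b c F) : F 0 = 1 := by
  rw [hF.2 0 (by simp), ordinaryHypergeometric_zero]

theorem symm (hF : IsGaussContinuation a b c F) : IsGaussContinuation b a c F := by
  refine ⟨hF.1, fun z hz => ?_⟩
  rw [hF.2 z hz, ordinaryHypergeometric, ordinaryHypergeometric, ordinaryHypergeometricSeries_symm]

theorem isGaussContinuation_hyp2F1 (hF : IsGaussContinuation a b c F) :
    IsGaussContinuation a b c (hyp2F1 a b c) :=
  ⟨hF.1.congr fun _ hz => (hF.eqOn_hyp2F1 hz).symm,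
    fun z hz => by rw [← hF.eqOn_hyp2F1 (ball_subset_cutPlane hz), hF.2 z hz]⟩

/-- Euler's transformation `₂F₁(a, b; c; z) = (1 - z) ^ (c - a - b) ₂F₁(c - a, c - b; c; z)` in the
case `c - a - b = 1`. -/
theorem one_sub_mul (hc : ∀ n : ℕ, a + b + 1 + n ≠ 0)
    (hF : IsGaussContinuation (a + 1) (b + 1) (a + b + 1) F) :
    IsGaussContinuation a b (a + b + 1) fun z => (1 - z) * F z := by
  refine isGaussContinuation_of_hasSum
    (DifferentiableOn.mul (by fun_prop) hF.differentiableOn) fun z hz => ?_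
  have hsum := hF.hasSum hz
  have hshift := ((hasSum_nat_add_iff' 1).mpr hsum).sub (hsum.mul_left z)
  refine (hasSum_nat_add_iff' 1).mp ?_
  convert hshift using 1
  · ext n
    rw [ordinaryHypergeometricCoefficient_succ_eq_sub a b (hc n)]
    ring
  · simp only [Finset.sum_range_one, ordinaryHypergeometricCoefficient, ascPochhammer_zero,
      Polynomial.eval_one]
    ring

end IsGaussContinuation

theorem hasFPowerSeriesOnBall_of_hasSum {f : ℂ → ℂ} {a : ℕ → ℂ}
    (hf : ∀ z : ℂ, ‖z‖ < 1 → HasSum (fun n => a n * z ^ n) (f z)) :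
    HasFPowerSeriesOnBall f (.ofScalars ℂ a) 0 1 := by
  refine ⟨ENNReal.le_of_forall_nnreal_lt fun r hr => ?_, one_pos, fun {z} hz => ?_⟩
  · refine FormalMultilinearSeries.le_radius_of_summable _ ?_
    simpa using (hf (r : ℂ) (by simpa using hr)).summable.norm
  · have hz' : ‖z‖ < 1 := by simpa [enorm_eq_nnnorm, ← NNReal.coe_lt_one] using hz
    simpa [mul_comm] using hf z hz'

theorem hasSum_deriv_of_hasSum {f : ℂ → ℂ} {a : ℕ → ℂ}
    (hf : ∀ z : ℂ, ‖z‖ < 1 → HasSum (fun n => a n * z ^ n) (f z)) {z : ℂ} (hz : ‖z‖ < 1) :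
    HasSum (fun n : ℕ => ((n : ℂ) + 1) * a (n + 1) * z ^ n) (deriv f z) := by
  have hz' : z ∈ Metric.eball (0 : ℂ) 1 := by
    simpa [enorm_eq_nnnorm, ← NNReal.coe_lt_one] using hz
  have h := ((hasFPowerSeriesOnBall_of_hasSum hf).fderiv.hasSum hz').mapL
    (ContinuousLinearMap.apply ℂ ℂ (1 : ℂ))
  simpa [FormalMultilinearSeries.derivSeries_coeff_one, FormalMultilinearSeries.coeff_ofScalars,
    mul_comm, mul_assoc] using h

theorem hasSum_deriv_mul_of_hasSum {f : ℂ → ℂ} {a : ℕ → ℂ}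
    (hf : ∀ z : ℂ, ‖z‖ < 1 → HasSum (fun n => a n * z ^ n) (f z)) {z : ℂ} (hz : ‖z‖ < 1) :
    HasSum (fun n : ℕ => ((n : ℂ) + 1) * a n * z ^ n) (deriv (fun w => w * f w) z) := by
  have hmul : ∀ w : ℂ, ‖w‖ < 1 →
      HasSum (fun n => (if n = 0 then 0 else a (n - 1)) * w ^ n) (w * f w) := by
    intro w hw
    refine (hasSum_nat_add_iff' 1).mp ?_
    simpa [pow_succ', mul_left_comm] using (hf w hw).mul_left w
  simpa using hasSum_deriv_of_hasSum hmul hz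

theorem deriv_deriv_mul_eq {a b : ℂ} {F G : ℂ → ℂ} (hF : IsGaussContinuation a b 2 F)
    (hG : IsGaussContinuation (a + 1) (b + 1) 2 G) :
    Set.EqOn (deriv (deriv fun z => z * F z)) (fun z => a * b * G z) cutPlane := by
  have hzF : DifferentiableOn ℂ (fun z => z * F z) cutPlane :=
    differentiableOn_id.mul hF.differentiableOn
  refine AnalyticOnNhd.eqOn_of_preconnected_of_eventuallyEq
    (((hzF.deriv isOpen_cutPlane).deriv isOpen_cutPlane).analyticOnNhd isOpen_cutPlane)
    ((hG.differentiableOn.const_mul (a * b)).analyticOnNhd isOpen_cutPlane)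
    isPreconnected_cutPlane zero_mem_cutPlane ?_
  filter_upwards [Metric.ball_mem_nhds (0 : ℂ) one_pos] with z hz
  have hz' : ‖z‖ < 1 := by simpa using hz
  refine (hasSum_deriv_of_hasSum (fun _ => hasSum_deriv_mul_of_hasSum fun _ => hF.hasSum)
    hz').unique (((hG.hasSum hz').mul_left (a * b)).congr_fun fun n => ?_)
  have hn : (2 : ℂ) + n ≠ 0 := by exact_mod_cast (by omega : 2 + n ≠ 0)
  have hcoeff := succ_mul_ordinaryHypergeometricCoefficient_succ_eq_shift a b hn
  push_cast
  linear_combination z ^ n * hcoeff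

/-! ### Euler's integral -/

/-- The weight `u ^ (b - 1) (1 - u) ^ (c - 1)` of the Beta integral, with which Euler's integral
represents `₂F₁`. -/
def betaWeight (b c : ℂ) (u : ℝ) : ℂ :=
  (u : ℂ) ^ (b - 1) * (1 - (u : ℂ)) ^ (c - 1)

/-- Euler's integral for `₂F₁(a, b; c; z)`, with the principal branch of `(1 - z u) ^ (-a)`; it
provides the continuation of the Gauss series when `0 < Re b < Re c`. -/
def eulerIntegral (a b c z : ℂ) : ℂ :=
  (Complex.betaIntegral b (c - b))⁻¹ *
    ∫ u in (0 : ℝ)..1, betaWeight b (c - b) u * (1 - z * u) ^ (-a)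

theorem intervalIntegrable_betaWeight {b c : ℂ} (hb : 0 < b.re) (hc : 0 < c.re) :
    IntervalIntegrable (betaWeight b c) volume 0 1 :=
  Complex.betaIntegral_convergent hb hc

theorem integral_betaWeight_mul_pow (b c : ℂ) (n : ℕ) :
    ∫ u in (0 : ℝ)..1, betaWeight b c u * (u : ℂ) ^ n = Complex.betaIntegral (b + n) c := by
  refine intervalIntegral.integral_congr_ae (Eventually.of_forall fun u hu => ?_)
  rw [Set.uIoc_of_le zero_le_one] at hu
  have hu0 : (u : ℂ) ≠ 0 := by exact_mod_cast hu.1.ne'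
  rw [betaWeight, show b + n - 1 = b - 1 + n by ring, Complex.cpow_add _ _ hu0,
    Complex.cpow_natCast]
  ring

theorem ne_neg_natCast_of_re_pos {s : ℂ} (hs : 0 < s.re) (m : ℕ) : s ≠ -m := by
  rintro rfl
  simp only [Complex.neg_re, Complex.natCast_re, Left.neg_pos_iff] at hs
  exact hs.not_ge m.cast_nonneg

theorem betaIntegral_ne_zero {b c : ℂ} (hb : 0 < b.re) (hc : 0 < c.re) :
    Complex.betaIntegral b c ≠ 0 := by
  rw [Complex.betaIntegral_eq_Gamma_mul_div b c hb hc]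
  exact div_ne_zero
    (mul_ne_zero (Complex.Gamma_ne_zero_of_re_pos hb) (Complex.Gamma_ne_zero_of_re_pos hc))
    (Complex.Gamma_ne_zero_of_re_pos (add_pos hb hc))

theorem betaIntegral_add_nat {b c : ℂ} (hb : 0 < b.re) (hc : 0 < c.re) (n : ℕ) :
    Complex.betaIntegral (b + n) c = Complex.betaIntegral b c *
      ((ascPochhammer ℂ n).eval b * ((ascPochhammer ℂ n).eval (b + c))⁻¹) := by
  have hbc : 0 < (b + c).re := add_pos hb hc
  have hbn : 0 < (b + n).re := add_pos_of_pos_of_nonneg hb n.cast_nonneg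
  have hΓb := Complex.Gamma_ne_zero_of_re_pos hb
  have hΓbc := Complex.Gamma_ne_zero_of_re_pos hbc
  rw [Complex.betaIntegral_eq_Gamma_mul_div _ _ hbn hc,
    Complex.betaIntegral_eq_Gamma_mul_div _ _ hb hc, add_right_comm,
    ← Complex.Gamma_add_nat_div_Gamma_eq b (ne_neg_natCast_of_re_pos hb),
    ← Complex.Gamma_add_nat_div_Gamma_eq (b + c) (ne_neg_natCast_of_re_pos hbc)]
  field_simp

theorem one_sub_mul_mem_slitPlane {z : ℂ} (hz : z ∈ cutPlane) {u : ℝ}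
    (hu : u ∈ Set.Icc (0 : ℝ) 1) : 1 - z * u ∈ Complex.slitPlane := by
  convert Complex.starConvex_one_slitPlane hz (a := 1 - u) (b := u)
    (by linarith [hu.2]) hu.1 (by ring) using 1
  simp only [Complex.real_smul]
  push_cast
  ring

theorem continuousOn_one_sub_mul_cpow (s : ℂ) :
    ContinuousOn (fun p : ℂ × ℝ => (1 - p.1 * (p.2 : ℂ)) ^ s)
      (cutPlane ×ˢ Set.Icc (0 : ℝ) 1) :=
  ContinuousOn.cpow_const (by fun_prop) fun _ hp => one_sub_mul_mem_slitPlane hp.1 hp.2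

theorem intervalIntegrable_betaWeight_mul_cpow {b c : ℂ} (hb : 0 < b.re) (hc : 0 < c.re) (s : ℂ)
    {z : ℂ} (hz : z ∈ cutPlane) :
    IntervalIntegrable (fun u : ℝ => betaWeight b c u * (1 - z * (u : ℂ)) ^ s) volume 0 1 := by
  refine (intervalIntegrable_betaWeight hb hc).mul_continuousOn ?_
  rw [Set.uIcc_of_le zero_le_one]
  exact (continuousOn_one_sub_mul_cpow s).comp (f := fun u : ℝ => (z, u)) (by fun_prop)
    fun _ hu => ⟨hz, hu⟩

theorem hasDerivAt_one_sub_mul_cpow (s : ℂ) {z : ℂ} (hz : z ∈ cutPlane) {u : ℝ}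
    (hu : u ∈ Set.Icc (0 : ℝ) 1) :
    HasDerivAt (fun z : ℂ => (1 - z * (u : ℂ)) ^ (-s)) (s * (u * (1 - z * u) ^ (-s - 1))) z := by
  have h : HasDerivAt (fun z : ℂ => 1 - z * (u : ℂ)) (-(u : ℂ)) z := by
    simpa using ((hasDerivAt_id z).mul_const (u : ℂ)).const_sub 1
  exact (h.cpow_const (c := -s) (one_sub_mul_mem_slitPlane hz hu)).congr_deriv (by ring)

theorem differentiableOn_eulerIntegral {a b c : ℂ} (hb : 0 < b.re) (hcb : 0 < (c - b).re) :
    DifferentiableOn ℂ (eulerIntegral a b c) cutPlane := by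
  intro z₀ hz₀
  obtain ⟨ε, hε, hball⟩ := Metric.nhds_basis_closedBall.mem_iff.mp (isOpen_cutPlane.mem_nhds hz₀)
  obtain ⟨C, hC⟩ := ((isCompact_closedBall z₀ ε).prod isCompact_Icc).exists_bound_of_continuousOn
    ((continuousOn_one_sub_mul_cpow (-a - 1)).mono (Set.prod_mono hball le_rfl))
  have hmem : ∀ {u : ℝ}, u ∈ Set.uIoc (0 : ℝ) 1 → u ∈ Set.Icc (0 : ℝ) 1 := fun hu =>
    Set.Ioc_subset_Icc_self (by rwa [Set.uIoc_of_le zero_le_one] at hu)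
  have hderiv := intervalIntegral.hasDerivAt_integral_of_dominated_loc_of_deriv_le
    (μ := volume) (a := 0) (b := 1) (x₀ := z₀) (s := Metric.closedBall z₀ ε)
    (F := fun z u => betaWeight b (c - b) u * (1 - z * (u : ℂ)) ^ (-a))
    (F' := fun z u => betaWeight b (c - b) u * (a * (u * (1 - z * (u : ℂ)) ^ (-a - 1))))
    (bound := fun u => ‖betaWeight b (c - b) u‖ * (‖a‖ * C))
    (Metric.closedBall_mem_nhds z₀ hε) ?_ (intervalIntegrable_betaWeight_mul_cpow hb hcb _ hz₀)
    ?_ ?_ ((intervalIntegrable_betaWeight hb hcb).norm.mul_const _) ?_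
  · exact (hderiv.2.differentiableAt.const_mul _).differentiableWithinAt
  · filter_upwards [isOpen_cutPlane.mem_nhds hz₀] with z hz
    exact (intervalIntegrable_betaWeight_mul_cpow hb hcb _ hz).aestronglyMeasurable_restrict_uIoc
  · have hint := (intervalIntegrable_betaWeight_mul_cpow hb hcb (-a - 1) hz₀).mul_continuousOn
      (g := fun u : ℝ => a * (u : ℂ)) (by fun_prop)
    refine hint.aestronglyMeasurable_restrict_uIoc.congr (Eventually.of_forall fun u => ?_)
    ring
  · refine Eventually.of_forall fun u hu z hz => ?_
    have hu1 : ‖(u : ℂ)‖ ≤ 1 := by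
      rw [Complex.norm_of_nonneg (hmem hu).1]
      exact (hmem hu).2
    rw [norm_mul, norm_mul, norm_mul]
    gcongr
    exact (mul_le_of_le_one_left (norm_nonneg _) hu1).trans (hC (z, u) ⟨hz, hmem hu⟩)
  · exact Eventually.of_forall fun u hu z hz =>
      (hasDerivAt_one_sub_mul_cpow a (hball hz) (hmem hu)).const_mul _

theorem hasSum_one_sub_cpow (a : ℂ) {z : ℂ} (hz : ‖z‖ < 1) :
    HasSum (fun n : ℕ => (n.factorial : ℂ)⁻¹ * (ascPochhammer ℂ n).eval a * z ^ n)
      ((1 - z) ^ (-a)) := by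
  have hchoose (n : ℕ) : Ring.choose (a + n - 1) n =
      ((n.factorial : ℂ))⁻¹ * (ascPochhammer ℂ n).eval a := by
    have h := Ring.factorial_nsmul_multichoose_eq_ascPochhammer a n
    rw [Ring.multichoose_eq, nsmul_eq_mul, Polynomial.ascPochhammer_smeval_eq_eval] at h
    rw [← h, inv_mul_cancel_left₀ (by exact_mod_cast n.factorial_ne_zero)]
  have h := (Complex.one_div_one_sub_cpow_hasFPowerSeriesOnBall_zero a).hasSum (y := z)
    (by simpa [enorm_eq_nnnorm, ← NNReal.coe_lt_one] using hz)
  simpa [Complex.cpow_neg, mul_comm, hchoose] using h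

theorem hasSum_eulerIntegral {a b c : ℂ} (hb : 0 < b.re) (hcb : 0 < (c - b).re) {z : ℂ}
    (hz : ‖z‖ < 1) :
    HasSum (fun n : ℕ => ordinaryHypergeometricCoefficient a b c n * z ^ n)
      (eulerIntegral a b c z) := by
  have hw := intervalIntegrable_betaWeight hb hcb
  have hmul : ∀ {u : ℝ}, u ∈ Set.uIoc (0 : ℝ) 1 → ‖z * (u : ℂ)‖ ≤ ‖z‖ := fun {u} hu => by
    rw [Set.uIoc_of_le zero_le_one] at hu
    rw [norm_mul, Complex.norm_of_nonneg hu.1.le]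
    exact mul_le_of_le_one_right (norm_nonneg z) hu.2
  set p : ℕ → ℂ := fun n => (n.factorial : ℂ)⁻¹ * (ascPochhammer ℂ n).eval a
  have hsum := intervalIntegral.hasSum_integral_of_dominated_convergence (μ := volume)
    (a := 0) (b := 1) (F := fun (n : ℕ) u => betaWeight b (c - b) u * (p n * (z * (u : ℂ)) ^ n))
    (f := fun u => betaWeight b (c - b) u * (1 - z * (u : ℂ)) ^ (-a))
    (fun n u => ‖betaWeight b (c - b) u‖ * ‖p n * z ^ n‖) ?_ ?_ ?_ ?_ ?_
  · refine (hsum.mul_left (Complex.betaIntegral b (c - b))⁻¹).congr_fun fun n => ?_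
    have hterm (u : ℝ) : betaWeight b (c - b) u * (p n * (z * (u : ℂ)) ^ n) =
        p n * z ^ n * (betaWeight b (c - b) u * (u : ℂ) ^ n) := by ring
    simp_rw [hterm]
    rw [intervalIntegral.integral_const_mul, integral_betaWeight_mul_pow,
      betaIntegral_add_nat hb hcb, add_sub_cancel]
    simp only [ordinaryHypergeometricCoefficient, p]
    field_simp [betaIntegral_ne_zero hb hcb]
  · exact fun n => hw.aestronglyMeasurable_restrict_uIoc.mul
      (Continuous.aestronglyMeasurable (by fun_prop))
  · refine fun n => Eventually.of_forall fun u hu => ?_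
    rw [norm_mul _ (p n * _), norm_mul (p n), norm_mul (p n), norm_pow, norm_pow]
    gcongr
    exact hmul hu
  · exact Eventually.of_forall fun u _ => (hasSum_one_sub_cpow a hz).summable.norm.mul_left _
  · simp_rw [tsum_mul_left]
    exact hw.norm.mul_const _
  · exact Eventually.of_forall fun u hu =>
      (hasSum_one_sub_cpow a ((hmul hu).trans_lt hz)).mul_left _

theorem isGaussContinuation_eulerIntegral {a b c : ℂ} (hb : 0 < b.re) (hcb : 0 < (c - b).re) :
    IsGaussContinuation a b c (eulerIntegral a b c) :=
  isGaussContinuation_of_hasSum (differentiableOn_eulerIntegral hb hcb)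
    fun _ => hasSum_eulerIntegral hb hcb

theorem norm_betaWeight_mul_rpow (b c : ℂ) (s : ℝ) {u : ℝ} (hu : 0 < u) :
    ‖betaWeight b c u‖ * u ^ (-s) = ‖betaWeight (b - s) c u‖ := by
  rw [betaWeight, betaWeight, norm_mul, norm_mul, Complex.norm_cpow_eq_rpow_re_of_pos hu,
    Complex.norm_cpow_eq_rpow_re_of_pos hu, mul_right_comm, ← Real.rpow_add hu]
  congr 2
  simp only [Complex.sub_re, Complex.one_re, Complex.ofReal_re]
  ring

theorem norm_one_add_mul_cpow_le {a : ℂ} {s x u : ℝ} (hs : 0 ≤ s) (hsa : s ≤ a.re) (hx : 0 ≤ x)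
    (hu : u ∈ Set.Ioc (0 : ℝ) 1) :
    ‖(1 - -(x : ℂ) * u) ^ (-a)‖ ≤ u ^ (-s) * (1 + x) ^ (-s) := by
  have hxu : 0 ≤ x * u := mul_nonneg hx hu.1.le
  rw [show 1 - -(x : ℂ) * u = ((1 + x * u : ℝ) : ℂ) by push_cast; ring,
    Complex.norm_cpow_eq_rpow_re_of_pos (by linarith), Complex.neg_re,
    ← Real.mul_rpow hu.1.le (by linarith)]
  calc (1 + x * u) ^ (-a.re) ≤ (1 + x * u) ^ (-s) :=
        Real.rpow_le_rpow_of_exponent_le (by linarith) (by linarith)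
    _ ≤ (u * (1 + x)) ^ (-s) :=
        Real.rpow_le_rpow_of_nonpos (mul_pos hu.1 (by linarith)) (by linarith [hu.2])
          (by linarith)

theorem norm_eulerIntegral_neg_le {a b c : ℂ} (hcb : 0 < (c - b).re) {s : ℝ} (hs : 0 ≤ s)
    (hsa : s ≤ a.re) (hsb : s < b.re) {x : ℝ} (hx : 0 ≤ x) :
    ‖eulerIntegral a b c (-(x : ℂ))‖ ≤ ‖(Complex.betaIntegral b (c - b))⁻¹‖ *
      (∫ u in (0 : ℝ)..1, ‖betaWeight (b - s) (c - b) u‖) * (1 + x) ^ (-s) := by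
  have hbs : 0 < (b - s : ℂ).re := by
    rw [Complex.sub_re, Complex.ofReal_re]
    linarith
  rw [eulerIntegral, norm_mul, mul_assoc, ← intervalIntegral.integral_mul_const]
  refine mul_le_mul_of_nonneg_left (intervalIntegral.norm_integral_le_of_norm_le zero_le_one
    (Eventually.of_forall fun u hu => ?_)
    ((intervalIntegrable_betaWeight hbs hcb).norm.mul_const _)) (norm_nonneg _)
  rw [norm_mul, ← norm_betaWeight_mul_rpow _ _ _ hu.1, mul_assoc]
  exact mul_le_mul_of_nonneg_left (norm_one_add_mul_cpow_le hs hsa hx hu) (norm_nonneg _)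

/-! ### The Stieltjes transform on the half-line -/

section Stieltjes

/-- The Stieltjes transform `∫₀^∞ f(t) / (1 + t + z) dt`, for `Re z > -1`. -/
def stieltjes (f : ℝ → ℂ) (z : ℂ) : ℂ :=
  ∫ t : ℝ, f t * (1 + (t : ℂ) + z)⁻¹ ∂volPos

/-- The moment `∫₀^∞ f(t) (1 + t) ^ (-n - 1) dt`, up to sign the `n`-th Taylor coefficient of
the Stieltjes transform at `0`. -/
def stieltjesMoment (f : ℝ → ℂ) (n : ℕ) : ℂ :=
  ∫ t : ℝ, f t * ((1 + (t : ℂ)) ^ (n + 1))⁻¹ ∂volPos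

theorem ae_volPos_of_forall_pos {p : ℝ → Prop} (h : ∀ t, 0 < t → p t) : ∀ᵐ t ∂volPos, p t :=
  (ae_restrict_mem measurableSet_Ioi).mono h

theorem one_add_add_ne_zero {z : ℂ} (hz : -1 < z.re) {t : ℝ} (ht : 0 ≤ t) :
    1 + (t : ℂ) + z ≠ 0 := by
  intro h
  have := congrArg Complex.re h
  simp only [Complex.add_re, Complex.one_re, Complex.ofReal_re, Complex.zero_re] at this
  linarith

theorem one_add_ofReal_ne_zero {t : ℝ} (ht : 0 ≤ t) : 1 + (t : ℂ) ≠ 0 := by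
  simpa using one_add_add_ne_zero (z := 0) (by simp) ht

theorem norm_one_add_ofReal {t : ℝ} (ht : 0 ≤ t) : ‖1 + (t : ℂ)‖ = 1 + t := by
  exact_mod_cast Complex.norm_of_nonneg (r := 1 + t) (by linarith)

theorem norm_inv_one_add_pow_le {t : ℝ} (ht : 0 ≤ t) (n : ℕ) :
    ‖((1 + (t : ℂ)) ^ (n + 1))⁻¹‖ ≤ (1 + t)⁻¹ := by
  rw [norm_inv, norm_pow, norm_one_add_ofReal ht]
  exact inv_anti₀ (by linarith) (le_self_pow₀ (by linarith) n.succ_ne_zero)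

theorem norm_inv_one_add_add_le {z : ℂ} {d : ℝ} (hd : 0 < d) (hz : -1 + d ≤ z.re) {t : ℝ}
    (ht : 0 ≤ t) : ‖(1 + (t : ℂ) + z)⁻¹‖ ≤ (min 1 d)⁻¹ * (1 + t)⁻¹ := by
  have : 0 < min 1 d := lt_min one_pos hd
  rw [norm_inv, ← mul_inv]
  refine inv_anti₀ (by positivity) (le_trans ?_ (Complex.re_le_norm _))
  simp only [Complex.add_re, Complex.one_re, Complex.ofReal_re]
  nlinarith [min_le_left 1 d, min_le_right 1 d]

theorem norm_mul_le_of_norm_le_inv_one_add {w k : ℂ} {K t : ℝ} (ht : 0 ≤ t)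
    (hk : ‖k‖ ≤ K * (1 + t)⁻¹) : ‖w * k‖ ≤ K * ‖w * (1 + (t : ℂ))⁻¹‖ := by
  rw [norm_mul, norm_mul, norm_inv, norm_one_add_ofReal ht, mul_left_comm]
  exact mul_le_mul_of_nonneg_left hk (norm_nonneg w)

variable {f : ℝ → ℂ}

theorem aestronglyMeasurable_of_integrable_mul_inv
    (hf : Integrable (fun t : ℝ => f t * (1 + (t : ℂ))⁻¹) volPos) :
    AEStronglyMeasurable f volPos := by
  refine (hf.aestronglyMeasurable.mul (g := fun t : ℝ => 1 + (t : ℂ))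
    (Measurable.aestronglyMeasurable (by fun_prop))).congr
    (ae_volPos_of_forall_pos fun t ht => ?_)
  exact inv_mul_cancel_right₀ (one_add_ofReal_ne_zero ht.le) _

theorem integrable_mul_of_norm_le_inv_one_add {k : ℝ → ℂ} {K : ℝ}
    (hf : Integrable (fun t : ℝ => f t * (1 + (t : ℂ))⁻¹) volPos)
    (hk : AEStronglyMeasurable k volPos) (hkb : ∀ t, 0 < t → ‖k t‖ ≤ K * (1 + t)⁻¹) :
    Integrable (fun t => f t * k t) volPos :=
  (hf.norm.const_mul K).mono' ((aestronglyMeasurable_of_integrable_mul_inv hf).mul hk)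
    (ae_volPos_of_forall_pos fun t ht => norm_mul_le_of_norm_le_inv_one_add ht.le (hkb t ht))

theorem integrable_stieltjesMoment
    (hf : Integrable (fun t : ℝ => f t * (1 + (t : ℂ))⁻¹) volPos) (n : ℕ) :
    Integrable (fun t : ℝ => f t * ((1 + (t : ℂ)) ^ (n + 1))⁻¹) volPos :=
  integrable_mul_of_norm_le_inv_one_add (K := 1) hf
    (Measurable.aestronglyMeasurable (by fun_prop))
    fun t ht => (norm_inv_one_add_pow_le ht.le n).trans_eq (one_mul _).symm

theorem integrable_stieltjes (hf : Integrable (fun t : ℝ => f t * (1 + (t : ℂ))⁻¹) volPos)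
    {z : ℂ} (hz : -1 < z.re) :
    Integrable (fun t : ℝ => f t * (1 + (t : ℂ) + z)⁻¹) volPos :=
  integrable_mul_of_norm_le_inv_one_add hf (Measurable.aestronglyMeasurable (by fun_prop))
    fun t ht => norm_inv_one_add_add_le (d := z.re + 1) (by linarith) (by linarith) ht.le

theorem tendsto_stieltjesMoment
    (hf : Integrable (fun t : ℝ => f t * (1 + (t : ℂ))⁻¹) volPos) :
    Tendsto (stieltjesMoment f) atTop (𝓝 0) := by
  rw [← integral_zero ℝ ℂ (μ := volPos)]
  refine tendsto_integral_of_dominated_convergence (fun t => 1 * ‖f t * (1 + (t : ℂ))⁻¹‖)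
    (fun n => (integrable_stieltjesMoment hf n).aestronglyMeasurable) (hf.norm.const_mul 1)
    (fun n => ae_volPos_of_forall_pos fun t ht => norm_mul_le_of_norm_le_inv_one_add ht.le
      ((norm_inv_one_add_pow_le ht.le n).trans_eq (one_mul _).symm))
    (ae_volPos_of_forall_pos fun t ht => ?_)
  have hlt : ‖(1 + (t : ℂ))⁻¹‖ < 1 := by
    rw [norm_inv, norm_one_add_ofReal ht.le]
    exact inv_lt_one_of_one_lt₀ (by linarith)
  simpa only [inv_pow, mul_zero] using
    ((tendsto_add_atTop_iff_nat 1).mpr (tendsto_pow_atTop_nhds_zero_of_norm_lt_one hlt)).const_mul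
      (f t)

theorem hasSum_inv_one_add_add {z : ℂ} (hz : ‖z‖ < 1) {t : ℝ} (ht : 0 ≤ t) :
    HasSum (fun n : ℕ => ((1 + (t : ℂ)) ^ (n + 1))⁻¹ * (-z) ^ n) (1 + (t : ℂ) + z)⁻¹ := by
  have h0 := one_add_ofReal_ne_zero ht
  have hlt : ‖-z / (1 + (t : ℂ))‖ < 1 := by
    rw [norm_div, norm_neg, norm_one_add_ofReal ht, div_lt_one (by linarith)]
    linarith
  have hinv : (1 + (t : ℂ))⁻¹ * (1 - -z / (1 + (t : ℂ)))⁻¹ = (1 + (t : ℂ) + z)⁻¹ := by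
    rw [← mul_inv]
    congr 1
    field_simp
    ring
  refine hinv ▸ ((hasSum_geometric_of_norm_lt_one hlt).mul_left _).congr_fun fun n => ?_
  rw [div_pow, pow_succ, mul_inv]
  ring

theorem hasSum_stieltjes (hf : Integrable (fun t : ℝ => f t * (1 + (t : ℂ))⁻¹) volPos)
    {z : ℂ} (hz : ‖z‖ < 1) :
    HasSum (fun n => stieltjesMoment f n * (-z) ^ n) (stieltjes f z) := by
  have hsum := hasSum_integral_of_dominated_convergence (μ := volPos)
    (F := fun (n : ℕ) (t : ℝ) => f t * (((1 + (t : ℂ)) ^ (n + 1))⁻¹ * (-z) ^ n))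
    (f := fun t => f t * (1 + (t : ℂ) + z)⁻¹)
    (fun n t => ‖z‖ ^ n * ‖f t * (1 + (t : ℂ))⁻¹‖) ?_ ?_ ?_ ?_ ?_
  · refine hsum.congr_fun fun n => ?_
    rw [stieltjesMoment, ← integral_mul_const]
    simp only [mul_assoc]
  · exact fun n => (aestronglyMeasurable_of_integrable_mul_inv hf).mul
      (Measurable.aestronglyMeasurable (by fun_prop))
  · refine fun n => ae_volPos_of_forall_pos fun t ht =>
      norm_mul_le_of_norm_le_inv_one_add ht.le ?_
    rw [norm_mul, norm_pow, norm_neg, mul_comm]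
    exact mul_le_mul_of_nonneg_left (norm_inv_one_add_pow_le ht.le n) (by positivity)
  · exact Eventually.of_forall fun t =>
      (summable_geometric_of_lt_one (norm_nonneg z) hz).mul_right _
  · simp_rw [tsum_mul_right]
    exact hf.norm.const_mul _
  · exact ae_volPos_of_forall_pos fun t ht => (hasSum_inv_one_add_add hz ht.le).mul_left (f t)

theorem isOpen_setOf_lt_re (e : ℝ) : IsOpen {z : ℂ | e < z.re} :=
  isOpen_lt continuous_const Complex.continuous_re

theorem differentiableOn_stieltjes
    (hf : Integrable (fun t : ℝ => f t * (1 + (t : ℂ))⁻¹) volPos) :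
    DifferentiableOn ℂ (stieltjes f) {z | -1 < z.re} := by
  intro z₀ (hz₀ : -1 < z₀.re)
  obtain ⟨e, he, hez₀⟩ := exists_between hz₀
  have hderiv := hasDerivAt_integral_of_dominated_loc_of_deriv_le (μ := volPos) (x₀ := z₀)
    (s := {z : ℂ | e < z.re}) (F := fun z (t : ℝ) => f t * (1 + (t : ℂ) + z)⁻¹)
    (F' := fun z (t : ℝ) => f t * (-1 / (1 + (t : ℂ) + z) ^ 2))
    (bound := fun t : ℝ => (min 1 (e + 1))⁻¹ ^ 2 * ‖f t * (1 + (t : ℂ))⁻¹‖)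
    ((isOpen_setOf_lt_re e).mem_nhds hez₀) ?_ (integrable_stieltjes hf hz₀) ?_ ?_
    (hf.norm.const_mul _) ?_
  · exact hderiv.2.differentiableAt.differentiableWithinAt
  · filter_upwards [(isOpen_setOf_lt_re (-1)).mem_nhds hz₀] with z hz
    exact (integrable_stieltjes hf hz).aestronglyMeasurable
  · exact (aestronglyMeasurable_of_integrable_mul_inv hf).mul
      (Measurable.aestronglyMeasurable (by fun_prop))
  · refine ae_volPos_of_forall_pos fun t ht z (hz : e < z.re) =>
      norm_mul_le_of_norm_le_inv_one_add ht.le ?_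
    have hle := norm_inv_one_add_add_le (d := e + 1) (by linarith) (by linarith : _ ≤ z.re) ht.le
    calc ‖-1 / (1 + (t : ℂ) + z) ^ 2‖ = ‖(1 + (t : ℂ) + z)⁻¹‖ ^ 2 := by
          rw [neg_div, norm_neg, one_div, ← inv_pow, norm_pow]
      _ ≤ ((min 1 (e + 1))⁻¹ * (1 + t)⁻¹) ^ 2 := pow_le_pow_left₀ (norm_nonneg _) hle 2
      _ = (min 1 (e + 1))⁻¹ ^ 2 * (1 + t)⁻¹ ^ 2 := mul_pow _ _ _
      _ ≤ (min 1 (e + 1))⁻¹ ^ 2 * (1 + t)⁻¹ := by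
          gcongr
          exact pow_le_of_le_one (by positivity) (inv_le_one_of_one_le₀ (by linarith)) two_ne_zero
  · exact ae_volPos_of_forall_pos fun t ht z (hz : e < z.re) =>
      (((hasDerivAt_id' z).const_add _).fun_inv
        (one_add_add_ne_zero (he.trans hz) ht.le)).const_mul _

end Stieltjes

/-! ### Moments of solutions of the hypergeometric equation -/

section Moments

theorem isLittleO_id_of_tendsto_deriv_zero {g g' : ℝ → ℂ}
    (hg : ∀ᶠ t in atTop, HasDerivAt g (g' t) t) (hg' : Tendsto g' atTop (𝓝 0)) :
    g =o[atTop] (id : ℝ → ℝ) := by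
  refine Asymptotics.isLittleO_iff.mpr fun c hc => ?_
  have hsmall : ∀ᶠ t in atTop, ‖g' t‖ ≤ c / 2 :=
    (tendsto_zero_iff_norm_tendsto_zero.mp hg').eventually_le_const (by linarith)
  obtain ⟨T, hT⟩ := eventually_atTop.mp (hg.and hsmall)
  filter_upwards [eventually_ge_atTop T, eventually_ge_atTop 0,
    eventually_ge_atTop (2 * ‖g T‖ / c - T)] with t hTt ht0 ht
  have hmean : ‖g t - g T‖ ≤ c / 2 * ‖t - T‖ :=
    (convex_Ici T).norm_image_sub_le_of_norm_hasDerivWithin_le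
      (fun u hu => (hT u hu).1.hasDerivWithinAt) (fun u hu => (hT u hu).2) Set.self_mem_Ici hTt
  rw [Real.norm_of_nonneg (sub_nonneg.mpr hTt)] at hmean
  rw [id, Real.norm_of_nonneg ht0]
  rw [sub_le_iff_le_add, div_le_iff₀ hc] at ht
  linarith [norm_sub_norm_le (g t) (g T)]

theorem hasDerivAt_inv_one_add_pow (n : ℕ) {t : ℝ} (ht : 0 ≤ t) :
    HasDerivAt (fun t : ℝ => ((1 + (t : ℂ)) ^ (n + 1))⁻¹)
      (-((n : ℂ) + 1) * ((1 + (t : ℂ)) ^ (n + 2))⁻¹) t := by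
  have h0 := one_add_ofReal_ne_zero ht
  have hlin : HasDerivAt (fun t : ℝ => 1 + (t : ℂ)) 1 t :=
    (Complex.ofRealCLM.hasDerivAt (x := t)).const_add 1
  refine ((hlin.fun_pow (n + 1)).fun_inv (pow_ne_zero _ h0)).congr_deriv ?_
  rw [Nat.add_sub_cancel]
  field_simp
  push_cast
  ring

theorem norm_inv_one_add_pow_mul_le (n : ℕ) {t : ℝ} (ht : 0 ≤ t) :
    ‖((1 + (t : ℂ)) ^ (n + 2))⁻¹ * ((t : ℂ) * (1 + t))‖ ≤ 1 := by
  have h0 := one_add_ofReal_ne_zero ht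
  have hcancel : ((1 + (t : ℂ)) ^ (n + 2))⁻¹ * ((t : ℂ) * (1 + t)) =
      ((1 + (t : ℂ)) ^ (n + 1))⁻¹ * t := by
    field_simp
    ring
  rw [hcancel, norm_mul, Complex.norm_of_nonneg ht]
  calc ‖((1 + (t : ℂ)) ^ (n + 1))⁻¹‖ * t ≤ (1 + t)⁻¹ * t :=
        mul_le_mul_of_nonneg_right (norm_inv_one_add_pow_le ht n) ht
    _ ≤ 1 := inv_mul_le_one_of_le₀ (by linarith) (by linarith)

variable {f Y' : ℝ → ℂ}

theorem tendsto_inv_one_add_pow_mul_add (n : ℕ) (hf : Tendsto f atTop (𝓝 0))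
    (hY' : Y' =o[atTop] (id : ℝ → ℝ)) :
    Tendsto (fun t : ℝ => ((1 + (t : ℂ)) ^ (n + 1))⁻¹ * Y' t +
      (n + 1) * ((1 + (t : ℂ)) ^ (n + 2))⁻¹ * ((t : ℂ) * (1 + t) * f t)) atTop (𝓝 0) := by
  have hlim : Tendsto (fun t : ℝ => ‖Y' t‖ / t + ‖(n + 1 : ℂ)‖ * ‖f t‖) atTop (𝓝 0) := by
    simpa using hY'.norm_left.tendsto_div_nhds_zero.add
      ((tendsto_zero_iff_norm_tendsto_zero.mp hf).const_mul ‖(n + 1 : ℂ)‖)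
  refine squeeze_zero_norm' ?_ hlim
  filter_upwards [eventually_gt_atTop 0] with t ht
  refine (norm_add_le _ _).trans (add_le_add ?_ ?_)
  · rw [norm_mul, div_eq_inv_mul]
    gcongr
    exact (norm_inv_one_add_pow_le ht.le n).trans (inv_anti₀ ht (by linarith))
  · rw [mul_assoc, ← mul_assoc _ _ (f t), norm_mul, norm_mul _ (f t)]
    gcongr
    exact mul_le_of_le_one_left (norm_nonneg _) (norm_inv_one_add_pow_mul_le n ht.le)

theorem stieltjesMoment_succ {κ : ℂ}
    (hf : Integrable (fun t : ℝ => f t * (1 + (t : ℂ))⁻¹) volPos) (hf0 : Tendsto f atTop (𝓝 0))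
    (hY : ∀ t : ℝ, 0 ≤ t → HasDerivAt (fun t : ℝ => (t : ℂ) * (1 + t) * f t) (Y' t) t)
    (hY' : ∀ t : ℝ, 0 ≤ t → HasDerivAt Y' (-(κ * f t)) t) (n : ℕ) :
    ((n : ℂ) + 1) * (n + 2) * stieltjesMoment f (n + 1) =
      ((n + 1) * (n + 2) + κ) * stieltjesMoment f n - Y' 0 := by
  have hlittle : Y' =o[atTop] (id : ℝ → ℝ) := by
    refine isLittleO_id_of_tendsto_deriv_zero ((eventually_ge_atTop 0).mono hY') ?_
    simpa using (hf0.const_mul κ).neg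
  have hint := (integrable_stieltjesMoment hf (n + 1)).const_mul ((n + 1) * (n + 2) : ℂ)
  have hint' := (integrable_stieltjesMoment hf n).const_mul ((n + 1) * (n + 2) + κ : ℂ)
  have hftc := integral_Ioi_of_hasDerivAt_of_tendsto' (a := 0)
    (f := fun t : ℝ => ((1 + (t : ℂ)) ^ (n + 1))⁻¹ * Y' t +
      (n + 1) * ((1 + (t : ℂ)) ^ (n + 2))⁻¹ * ((t : ℂ) * (1 + t) * f t))
    (f' := fun t : ℝ => ((n : ℂ) + 1) * (n + 2) * (f t * ((1 + (t : ℂ)) ^ (n + 1 + 1))⁻¹) -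
      ((n + 1) * (n + 2) + κ) * (f t * ((1 + (t : ℂ)) ^ (n + 1))⁻¹)) (fun t ht => ?_)
    (hint.sub hint') (tendsto_inv_one_add_pow_mul_add n hf0 hlittle)
  · change ∫ t, _ ∂volPos = _ at hftc
    rw [integral_sub hint hint', integral_const_mul, integral_const_mul] at hftc
    simp only [Complex.ofReal_zero, add_zero, one_pow, inv_one, one_mul, zero_mul, mul_zero,
      zero_sub] at hftc
    rw [stieltjesMoment, stieltjesMoment]
    linear_combination hftc
  · have ht0 : 0 ≤ t := ht
    have h0 := one_add_ofReal_ne_zero ht0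
    refine (((hasDerivAt_inv_one_add_pow n ht0).fun_mul (hY' t ht0)).add
      (((hasDerivAt_inv_one_add_pow (n + 1) ht0).const_mul ((n : ℂ) + 1)).fun_mul
        (hY t ht0))).congr_deriv ?_
    push_cast
    field_simp
    ring

/-- `A + λ M - c` satisfies the homogeneous recurrence, hence is a multiple of `A`; as it tends to
`0` while `A` tends to `c ≠ 0`, the multiple is zero. -/
theorem add_mul_eq_of_recurrence {A M r : ℕ → ℂ} {κ c : ℂ} (hc : c ≠ 0) (hr : ∀ n, r n ≠ 0)
    (hA0 : A 0 = 1) (hA : ∀ n, r n * A (n + 1) = (r n + κ) * A n) (hAc : Tendsto A atTop (𝓝 c))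
    (hM : ∀ n, r n * M (n + 1) = (r n + κ) * M n - 1) (hM0 : Tendsto M atTop (𝓝 0)) (n : ℕ) :
    A n + c * κ * M n = c := by
  set δ := A 0 + c * κ * M 0 - c
  have hmul (n : ℕ) : A n + c * κ * M n - c = δ * A n := by
    induction n with
    | zero => rw [hA0, mul_one, ← hA0]
    | succ n ih =>
      refine mul_left_cancel₀ (hr n) ?_
      linear_combination (1 - δ) * hA n + c * κ * hM n + (r n + κ) * ih
  have hlim : Tendsto (fun n => δ * A n) atTop (𝓝 0) := by
    simpa [← hmul] using (hAc.add (hM0.const_mul (c * κ))).sub_const c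
  have hδ : δ * c = 0 := tendsto_nhds_unique (hAc.const_mul δ) hlim
  have := hmul n
  rw [(mul_eq_zero.mp hδ).resolve_right hc, zero_mul] at this
  exact sub_eq_zero.mp this

end Moments

/-! ### The function `φ` -/

section GaussPhi

/-- The function `₂F₁(1 + α, 2 - α; 2; -z)` for a general parameter `α`, which is the `φ` of the
theorem when `α = α_λ`. -/
def gaussPhi (al z : ℂ) : ℂ :=
  hyp2F1 (1 + al) (2 - al) 2 (-z)

variable {al : ℂ}

theorem re_one_add_pos (hal : al.re ∈ Set.Ioo (-1 : ℝ) 1) : 0 < (1 + al).re := by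
  simpa using neg_lt_iff_pos_add'.mp hal.1

theorem re_two_sub_pos (hal : al.re ∈ Set.Ioo (-1 : ℝ) 1) : 0 < (2 - al).re := by
  simpa using hal.2.trans one_lt_two

theorem isGaussContinuation_hyp2F1_one_add (hal : al.re ∈ Set.Ioo (-1 : ℝ) 1) :
    IsGaussContinuation (1 + al) (2 - al) 2 (hyp2F1 (1 + al) (2 - al) 2) := by
  refine (isGaussContinuation_eulerIntegral (a := 2 - al) (re_one_add_pos hal)
    ?_).symm.isGaussContinuation_hyp2F1
  rw [← sub_sub]
  norm_num [hal.2]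

theorem isGaussContinuation_one_sub_mul_hyp2F1 (hal : al.re ∈ Set.Ioo (-1 : ℝ) 1) :
    IsGaussContinuation al (1 - al) 2 fun z => (1 - z) * hyp2F1 (1 + al) (2 - al) 2 z := by
  have hcont := isGaussContinuation_hyp2F1_one_add hal
  rw [show 1 + al = al + 1 by ring, show 2 - al = 1 - al + 1 by ring,
    show (2 : ℂ) = al + (1 - al) + 1 by ring] at hcont
  convert hcont.one_sub_mul fun n => ?_ using 1
  · ring
  · ext z
    ring_nf
  · rw [show al + (1 - al) + 1 + (n : ℂ) = ((n + 2 : ℕ) : ℂ) by push_cast; ring]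
    exact Nat.cast_ne_zero.mpr (by omega)

theorem differentiableOn_gaussPhi (hal : al.re ∈ Set.Ioo (-1 : ℝ) 1) :
    DifferentiableOn ℂ (gaussPhi al) {z | -1 < z.re} :=
  (isGaussContinuation_hyp2F1_one_add hal).differentiableOn.comp (differentiableOn_neg _)
    fun _ => neg_mem_cutPlane

theorem hasSum_gaussPhi (hal : al.re ∈ Set.Ioo (-1 : ℝ) 1) {z : ℂ} (hz : ‖z‖ < 1) :
    HasSum (fun n => ordinaryHypergeometricCoefficient (1 + al) (2 - al) 2 n * (-z) ^ n)
      (gaussPhi al z) :=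
  (isGaussContinuation_hyp2F1_one_add hal).hasSum (by rwa [norm_neg])

theorem gaussPhi_zero (hal : al.re ∈ Set.Ioo (-1 : ℝ) 1) : gaussPhi al 0 = 1 := by
  rw [gaussPhi, neg_zero, (isGaussContinuation_hyp2F1_one_add hal).apply_zero]

theorem exists_norm_gaussPhi_le (hal : al.re < 1) {s : ℝ} (hs0 : 0 ≤ s) (hs1 : s ≤ 1)
    (hs : s < 1 + al.re) :
    ∃ C : ℝ, ∀ x : ℝ, 0 ≤ x → ‖gaussPhi al x‖ ≤ C * (1 + x) ^ (-s) := by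
  have hb : s < (1 + al).re := by simpa using hs
  have hcb : 0 < (2 - (1 + al)).re := by
    rw [← sub_sub]
    norm_num [hal]
  refine ⟨‖(Complex.betaIntegral (1 + al) (2 - (1 + al)))⁻¹‖ *
    ∫ u in (0 : ℝ)..1, ‖betaWeight (1 + al - s) (2 - (1 + al)) u‖, fun x hx => ?_⟩
  rw [gaussPhi, ← (isGaussContinuation_eulerIntegral (hs0.trans_lt hb) hcb).symm.eqOn_hyp2F1
    (neg_ofReal_mem_cutPlane hx)]
  exact norm_eulerIntegral_neg_le hcb hs0 (by simp; linarith) hb hx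

theorem aestronglyMeasurable_gaussPhi (hal : al.re ∈ Set.Ioo (-1 : ℝ) 1) :
    AEStronglyMeasurable (fun t : ℝ => gaussPhi al t) volPos := by
  refine ContinuousOn.aestronglyMeasurable ?_ measurableSet_Ioi
  refine (differentiableOn_gaussPhi hal).continuousOn.comp (by fun_prop) fun t ht => ?_
  simpa using neg_one_lt_zero.trans ht

theorem exists_pos_lt_one_add_re (hal : -1 < al.re) : ∃ s, 0 < s ∧ s ≤ 1 ∧ s < 1 + al.re := by
  obtain ⟨s, hs0, hs⟩ := exists_between
    (show (0 : ℝ) < min 1 (1 + al.re) from lt_min one_pos (by linarith))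
  exact ⟨s, hs0, (lt_min_iff.mp hs).1.le, (lt_min_iff.mp hs).2⟩

theorem tendsto_one_add_rpow_neg {s : ℝ} (hs : 0 < s) :
    Tendsto (fun t : ℝ => (1 + t) ^ (-s)) atTop (𝓝 0) :=
  (tendsto_rpow_neg_atTop hs).comp (tendsto_atTop_add_const_left _ 1 tendsto_id)

theorem integrable_one_add_rpow_neg {r : ℝ} (hr : 1 < r) :
    Integrable (fun t : ℝ => (1 + t) ^ (-r)) volPos := by
  simpa only [volPos, IntegrableOn, add_comm] using
    integrableOn_add_rpow_Ioi_of_lt (a := -r) (c := 0) (m := 1) (by linarith) (by norm_num)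

theorem tendsto_gaussPhi_atTop (hal : al.re ∈ Set.Ioo (-1 : ℝ) 1) :
    Tendsto (fun t : ℝ => gaussPhi al t) atTop (𝓝 0) := by
  obtain ⟨s, hs0, hs1, hs⟩ := exists_pos_lt_one_add_re hal.1
  obtain ⟨C, hC⟩ := exists_norm_gaussPhi_le hal.2 hs0.le hs1 hs
  refine squeeze_zero_norm' ((eventually_ge_atTop 0).mono hC) ?_
  simpa using (tendsto_one_add_rpow_neg hs0).const_mul C

theorem integrable_gaussPhi_mul_inv (hal : al.re ∈ Set.Ioo (-1 : ℝ) 1) :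
    Integrable (fun t : ℝ => gaussPhi al t * (1 + (t : ℂ))⁻¹) volPos := by
  obtain ⟨s, hs0, hs1, hs⟩ := exists_pos_lt_one_add_re hal.1
  obtain ⟨C, hC⟩ := exists_norm_gaussPhi_le hal.2 hs0.le hs1 hs
  refine ((integrable_one_add_rpow_neg (r := s + 1) (by linarith)).const_mul C).mono'
    ((aestronglyMeasurable_gaussPhi hal).mul (Measurable.aestronglyMeasurable (by fun_prop)))
    (ae_volPos_of_forall_pos fun t ht => ?_)
  rw [norm_mul, norm_inv, norm_one_add_ofReal ht.le, neg_add, Real.rpow_add (by linarith),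
    Real.rpow_neg_one, ← mul_assoc]
  exact mul_le_mul_of_nonneg_right (hC t ht.le) (by positivity)

theorem memLp_gaussPhi (hal : al.re ∈ Set.Ioo (-(1 / 2) : ℝ) 1) :
    MemLp (fun t : ℝ => gaussPhi al t) 2 volPos := by
  obtain ⟨s, hs2, hs⟩ := exists_between (show (1 / 2 : ℝ) < min 1 (1 + al.re) from
    lt_min (by norm_num) (by linarith [hal.1]))
  obtain ⟨C, hC⟩ := exists_norm_gaussPhi_le hal.2 (by linarith) (lt_min_iff.mp hs).1.le
    (lt_min_iff.mp hs).2
  have hmeas := aestronglyMeasurable_gaussPhi ⟨by linarith [hal.1], hal.2⟩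
  refine (memLp_two_iff_integrable_sq_norm hmeas).mpr
    (((integrable_one_add_rpow_neg (r := s * 2) (by linarith)).const_mul (C ^ 2)).mono'
      (hmeas.norm.pow 2) (ae_volPos_of_forall_pos fun t ht => ?_))
  rw [Real.norm_of_nonneg (by positivity), ← neg_mul, Real.rpow_mul (by linarith),
    Real.rpow_two, ← mul_pow]
  exact pow_le_pow_left₀ (norm_nonneg _) (hC t ht.le) 2

theorem exists_hasDerivAt_mul_gaussPhi (hal : al.re ∈ Set.Ioo (-1 : ℝ) 1) :
    ∃ Y' : ℝ → ℂ, Y' 0 = 1 ∧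
      (∀ t : ℝ, 0 ≤ t →
        HasDerivAt (fun t : ℝ => (t : ℂ) * (1 + t) * gaussPhi al t) (Y' t) t) ∧
      ∀ t : ℝ, 0 ≤ t → HasDerivAt Y' (-(al * (1 - al) * gaussPhi al t)) t := by
  have hF := isGaussContinuation_one_sub_mul_hyp2F1 hal
  have hG := isGaussContinuation_hyp2F1_one_add hal
  set W : ℂ → ℂ := fun z => z * ((1 - z) * hyp2F1 (1 + al) (2 - al) 2 z)
  have hW : DifferentiableOn ℂ W cutPlane := differentiableOn_id.mul hF.differentiableOn
  have hneg (t : ℝ) : HasDerivAt (fun t : ℝ => -(t : ℂ)) (-1) t :=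
    (Complex.ofRealCLM.hasDerivAt (x := t)).neg
  have hmem {t : ℝ} (ht : 0 ≤ t) : cutPlane ∈ 𝓝 (-(t : ℂ)) :=
    isOpen_cutPlane.mem_nhds (neg_ofReal_mem_cutPlane ht)
  refine ⟨fun t => deriv W (-(t : ℂ)), ?_, fun t ht => ?_, fun t ht => ?_⟩
  · have hprod := (hasDerivAt_id' (0 : ℂ)).fun_mul
      (hF.differentiableOn.differentiableAt (isOpen_cutPlane.mem_nhds zero_mem_cutPlane)).hasDerivAt
    simp only [Complex.ofReal_zero, neg_zero, W, hprod.deriv, hG.apply_zero]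
    ring
  · have hcomp := ((hW.differentiableAt (hmem ht)).hasDerivAt.comp t (hneg t)).neg
    refine (hcomp.congr_deriv (by ring)).congr_of_eventuallyEq (Eventually.of_forall fun u => ?_)
    simp only [W, gaussPhi, Pi.neg_apply, Function.comp_apply]
    ring
  · have hderiv := ((hW.deriv isOpen_cutPlane).differentiableAt (hmem ht)).hasDerivAt
    have hode := deriv_deriv_mul_eq hF
      (by rwa [add_comm al, show 1 - al + 1 = 2 - al by ring]) (neg_ofReal_mem_cutPlane ht)
    rw [hode] at hderiv
    refine (hderiv.comp t (hneg t)).congr_deriv ?_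
    simp only [gaussPhi]
    ring

/-- The constant `(Γ(1 + α) Γ(2 - α))⁻¹`, the limit of the Taylor coefficients of `φ(-z)`; it is the
`c_λ` of the theorem when `α = α_λ`. -/
def gaussPhiConst (al : ℂ) : ℂ :=
  (Complex.Gamma (1 + al) * Complex.Gamma (2 - al))⁻¹

theorem gaussPhiConst_ne_zero (hal : al.re ∈ Set.Ioo (-1 : ℝ) 1) : gaussPhiConst al ≠ 0 :=
  inv_ne_zero (mul_ne_zero (Complex.Gamma_ne_zero_of_re_pos (re_one_add_pos hal))
    (Complex.Gamma_ne_zero_of_re_pos (re_two_sub_pos hal)))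

theorem tendsto_ordinaryHypergeometricCoefficient_gaussPhiConst
    (hal : al.re ∈ Set.Ioo (-1 : ℝ) 1) :
    Tendsto (ordinaryHypergeometricCoefficient (1 + al) (2 - al) 2) atTop
      (𝓝 (gaussPhiConst al)) := by
  have h := tendsto_ordinaryHypergeometricCoefficient (c := 2)
    (ne_neg_natCast_of_re_pos (re_one_add_pos hal)) (ne_neg_natCast_of_re_pos (re_two_sub_pos hal))
    (by ring)
  rwa [show Complex.Gamma 2 = 1 by simp, one_div] at h

theorem gaussPhiConst_mul (hal : al.re < 1) :
    gaussPhiConst al * (al * (1 - al)) = Complex.sin (al * Real.pi) / Real.pi := by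
  rcases eq_or_ne al 0 with rfl | h0
  · simp
  have h1 : 1 - al ≠ 0 := by
    intro h
    simp [← sub_eq_zero.mp h] at hal
  rw [gaussPhiConst, add_comm, Complex.Gamma_add_one al h0, show 2 - al = 1 - al + 1 by ring,
    Complex.Gamma_add_one _ h1, mul_mul_mul_comm,
    Complex.Gamma_mul_Gamma_one_sub, mul_comm al (Real.pi : ℂ)]
  field_simp

theorem ordinaryHypergeometricCoefficient_add_stieltjesMoment (hal : al.re ∈ Set.Ioo (-1 : ℝ) 1)
    (n : ℕ) :
    ordinaryHypergeometricCoefficient (1 + al) (2 - al) 2 n +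
      gaussPhiConst al * (al * (1 - al)) * stieltjesMoment (fun t => gaussPhi al t) n =
      gaussPhiConst al := by
  obtain ⟨Y', hY0, hY, hY'⟩ := exists_hasDerivAt_mul_gaussPhi hal
  have hint := integrable_gaussPhi_mul_inv hal
  refine add_mul_eq_of_recurrence (r := fun n => ((n : ℂ) + 1) * (n + 2))
    (gaussPhiConst_ne_zero hal) (fun n => ?_) (by simp [ordinaryHypergeometricCoefficient])
    (fun n => ?_) (tendsto_ordinaryHypergeometricCoefficient_gaussPhiConst hal) (fun n => ?_)
    (tendsto_stieltjesMoment hint) n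
  · exact mul_ne_zero n.cast_add_one_ne_zero (by exact_mod_cast (n + 1).succ_ne_zero)
  · have hrec := succ_mul_ordinaryHypergeometricCoefficient_succ (1 + al) (2 - al) (c := 2) (n := n)
      (by exact_mod_cast (show 2 + n ≠ 0 by omega))
    linear_combination hrec
  · simpa only [hY0] using stieltjesMoment_succ hint (tendsto_gaussPhi_atTop hal) hY hY' n

theorem gaussPhi_add_stieltjes (hal : al.re ∈ Set.Ioo (-1 : ℝ) 1) {z : ℂ} (hz : -1 < z.re) :
    gaussPhi al z + Complex.sin (al * Real.pi) / Real.pi * stieltjes (fun t => gaussPhi al t) z =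
      gaussPhiConst al * (1 + z)⁻¹ := by
  rw [← gaussPhiConst_mul hal.2]
  have hint := integrable_gaussPhi_mul_inv hal
  have hopen := isOpen_setOf_lt_re (-1)
  have hinv : DifferentiableOn ℂ (fun z : ℂ => gaussPhiConst al * (1 + z)⁻¹) {z | -1 < z.re} :=
    (DifferentiableOn.inv (by fun_prop) fun z hz => by
      simpa using one_add_add_ne_zero hz le_rfl).const_mul _
  refine AnalyticOnNhd.eqOn_of_preconnected_of_eventuallyEq
    (((differentiableOn_gaussPhi hal).add
      ((differentiableOn_stieltjes hint).const_mul _)).analyticOnNhd hopen)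
    (hinv.analyticOnNhd hopen) (convex_halfSpace_re_gt (-1)).isPreconnected (z₀ := 0) (by simp)
    ?_ hz
  filter_upwards [Metric.ball_mem_nhds (0 : ℂ) one_pos] with w hw
  have hw' : ‖w‖ < 1 := by simpa using hw
  have hgeom := (hasSum_geometric_of_norm_lt_one (ξ := -w) (by rwa [norm_neg])).mul_left
    (gaussPhiConst al)
  rw [sub_neg_eq_add] at hgeom
  refine ((hasSum_gaussPhi hal hw').add ((hasSum_stieltjes hint hw').mul_left _)).unique
    (hgeom.congr_fun fun n => ?_)
  linear_combination (-w) ^ n * ordinaryHypergeometricCoefficient_add_stieltjesMoment hal n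

end GaussPhi

/-! ### Hilbert's inequality -/

section HilbertForm

instance sFinite_volPos : SFinite volPos :=
  inferInstanceAs (SFinite (volume.restrict (Set.Ioi 0)))

theorem ae_volPos_prod_of_forall_pos {p : ℝ × ℝ → Prop} (h : ∀ x t, 0 < x → 0 < t → p (x, t)) :
    ∀ᵐ q ∂volPos.prod volPos, p q := by
  rw [volPos, Measure.prod_restrict]
  exact (ae_restrict_mem (measurableSet_Ioi.prod measurableSet_Ioi)).mono
    fun q hq => h q.1 q.2 hq.1 hq.2

theorem hasDerivAt_arctan_sqrt_div_sqrt {a t : ℝ} (ha : 0 < a) (ht : 0 < t) :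
    HasDerivAt (fun t => 2 / √a * Real.arctan (√t / √a)) ((√t)⁻¹ * (a + t)⁻¹) t := by
  have : 0 < √a := Real.sqrt_pos.mpr ha
  refine ((((Real.hasDerivAt_sqrt ht.ne').div_const (√a)).arctan).const_mul
    (2 / √a)).congr_deriv ?_
  rw [div_pow, Real.sq_sqrt ha.le, Real.sq_sqrt ht.le]
  field_simp
  rw [Real.sq_sqrt ha.le]

theorem tendsto_arctan_sqrt_div_sqrt {a : ℝ} (ha : 0 < a) :
    Tendsto (fun t => 2 / √a * Real.arctan (√t / √a)) atTop (𝓝 (2 / √a * (Real.pi / 2))) :=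
  ((Real.tendsto_arctan_atTop.mono_right nhdsWithin_le_nhds).comp
    (Real.tendsto_sqrt_atTop.atTop_div_const (Real.sqrt_pos.mpr ha))).const_mul _

theorem integrable_inv_sqrt_mul_inv_add {a : ℝ} (ha : 0 < a) :
    Integrable (fun t => (√t)⁻¹ * (a + t)⁻¹) volPos :=
  integrableOn_Ioi_deriv_of_nonneg (by fun_prop)
    (fun _ ht => hasDerivAt_arctan_sqrt_div_sqrt ha ht)
    (fun t (ht : 0 < t) => by positivity) (tendsto_arctan_sqrt_div_sqrt ha)

theorem integral_inv_sqrt_mul_inv_add {a : ℝ} (ha : 0 < a) :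
    ∫ t, (√t)⁻¹ * (a + t)⁻¹ ∂volPos = Real.pi / √a := by
  rw [volPos, integral_Ioi_of_hasDerivAt_of_nonneg (by fun_prop)
    (fun _ ht => hasDerivAt_arctan_sqrt_div_sqrt ha ht)
    (fun t (ht : 0 < t) => by positivity) (tendsto_arctan_sqrt_div_sqrt ha)]
  simp

variable {m : ℝ} {g : ℝ → ℂ}

/-- The majorant of the Hilbert kernel `1 / (m + x + t)` given by Schur's test with the weight
`x ^ (-1/2)`. -/
def schurMajorant (m : ℝ) (g : ℝ → ℂ) (p : ℝ × ℝ) : ℝ :=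
  ‖g p.1‖ ^ 2 * (√p.1 * ((√p.2)⁻¹ * (m + p.1 + p.2)⁻¹))

theorem schurMajorant_nonneg (hm : 0 ≤ m) {x t : ℝ} (hx : 0 < x) (ht : 0 < t) :
    0 ≤ schurMajorant m g (x, t) := by
  unfold schurMajorant
  positivity

theorem integral_schurMajorant_right (hm : 0 ≤ m) {x : ℝ} (hx : 0 < x) :
    ∫ t, schurMajorant m g (x, t) ∂volPos = ‖g x‖ ^ 2 * (√x * (Real.pi / √(m + x))) := by
  simp only [schurMajorant]
  rw [integral_const_mul, integral_const_mul, integral_inv_sqrt_mul_inv_add (by linarith)]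

theorem integral_schurMajorant_right_le (hm : 0 ≤ m) {x : ℝ} (hx : 0 < x) :
    ∫ t, schurMajorant m g (x, t) ∂volPos ≤ Real.pi * ‖g x‖ ^ 2 := by
  have hratio : √x / √(m + x) ≤ 1 :=
    div_le_one_of_le₀ (Real.sqrt_le_sqrt (by linarith)) (Real.sqrt_nonneg _)
  rw [integral_schurMajorant_right hm hx, mul_comm Real.pi, mul_div_left_comm]
  exact mul_le_mul_of_nonneg_left (mul_le_of_le_one_right Real.pi_pos.le hratio) (sq_nonneg _)

theorem integrable_schurMajorant (hm : 0 ≤ m) (hg : MemLp g 2 volPos) :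
    Integrable (schurMajorant m g) (volPos.prod volPos) := by
  have hmeas : AEStronglyMeasurable (schurMajorant m g) (volPos.prod volPos) :=
    (hg.1.norm.pow 2).comp_fst.mul (Measurable.aestronglyMeasurable (by fun_prop))
  refine (integrable_prod_iff hmeas).mpr ⟨ae_volPos_of_forall_pos fun x hx => ?_, ?_⟩
  · exact ((integrable_inv_sqrt_mul_inv_add (add_pos_of_nonneg_of_pos hm hx)).const_mul
      (√x)).const_mul (‖g x‖ ^ 2)
  · refine (((memLp_two_iff_integrable_sq_norm hg.1).mp hg).const_mul Real.pi).mono'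
      hmeas.norm.integral_prod_right' (ae_volPos_of_forall_pos fun x hx => ?_)
    rw [Real.norm_of_nonneg (integral_nonneg fun t => norm_nonneg _)]
    refine (integral_congr_ae (ae_volPos_of_forall_pos fun t ht => ?_)).trans_le
      (integral_schurMajorant_right_le hm hx)
    exact Real.norm_of_nonneg (schurMajorant_nonneg hm hx ht)

theorem integral_schurMajorant_le (hm : 0 ≤ m) (hg : MemLp g 2 volPos) :
    ∫ p, schurMajorant m g p ∂volPos.prod volPos ≤ Real.pi * ∫ x, ‖g x‖ ^ 2 ∂volPos := by
  have hint := integrable_schurMajorant hm hg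
  rw [integral_prod _ hint, ← integral_const_mul]
  exact integral_mono_ae hint.integral_prod_left
    (((memLp_two_iff_integrable_sq_norm hg.1).mp hg).const_mul _)
    (ae_volPos_of_forall_pos fun x hx => integral_schurMajorant_right_le hm hx)

/-- The integrand `conj (g x) g(t) / (m + x + t)` of the Hilbert form. -/
def hilbertIntegrand (m : ℝ) (g : ℝ → ℂ) (p : ℝ × ℝ) : ℂ :=
  conj (g p.1) * (g p.2 * ((m + p.1 + p.2 : ℝ) : ℂ)⁻¹)

/-- The quadratic form of the Hilbert kernel `1 / (m + x + t)` on `L²(ℝ₊)`. -/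
def hilbertForm (m : ℝ) (g : ℝ → ℂ) : ℂ :=
  ∫ p, hilbertIntegrand m g p ∂volPos.prod volPos

theorem norm_hilbertIntegrand_le (hm : 0 ≤ m) {x t : ℝ} (hx : 0 < x) (ht : 0 < t) :
    ‖hilbertIntegrand m g (x, t)‖ ≤
      2⁻¹ * (schurMajorant m g (x, t) + schurMajorant m g (t, x)) := by
  have : 0 < √x := Real.sqrt_pos.mpr hx
  have : 0 < √t := Real.sqrt_pos.mpr ht
  simp only [hilbertIntegrand, schurMajorant]
  rw [norm_mul, norm_mul, norm_inv, Complex.norm_of_nonneg (by linarith), RCLike.norm_conj,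
    add_right_comm m t x]
  -- AM-GM: the difference of the two sides is a multiple of this square.
  have hsq : 0 ≤ 2⁻¹ * (√x * √t)⁻¹ * (m + x + t)⁻¹ * (‖g x‖ * √x - ‖g t‖ * √t) ^ 2 := by
    positivity
  refine sub_nonneg.mp (hsq.trans_eq ?_)
  field_simp
  ring

theorem integrable_hilbertIntegrand (hm : 0 ≤ m) (hg : MemLp g 2 volPos) :
    Integrable (hilbertIntegrand m g) (volPos.prod volPos) := by
  have hint := integrable_schurMajorant hm hg
  refine ((hint.add hint.swap).const_mul 2⁻¹).mono' ?_
    (ae_volPos_prod_of_forall_pos fun x t hx ht => norm_hilbertIntegrand_le hm hx ht)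
  exact (Complex.continuous_conj.comp_aestronglyMeasurable hg.1.comp_fst).mul
    (hg.1.comp_snd.mul (Measurable.aestronglyMeasurable (by fun_prop)))

theorem norm_hilbertForm_le (hm : 0 ≤ m) (hg : MemLp g 2 volPos) :
    ‖hilbertForm m g‖ ≤ Real.pi * ∫ x, ‖g x‖ ^ 2 ∂volPos := by
  have hint := integrable_schurMajorant hm hg
  calc ‖hilbertForm m g‖
      ≤ ∫ p, 2⁻¹ * (schurMajorant m g p + schurMajorant m g p.swap) ∂volPos.prod volPos :=
        norm_integral_le_of_norm_le ((hint.add hint.swap).const_mul 2⁻¹)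
          (ae_volPos_prod_of_forall_pos fun x t hx ht => norm_hilbertIntegrand_le hm hx ht)
    _ = ∫ p, schurMajorant m g p ∂volPos.prod volPos := by
        have hadd := integral_add hint hint.swap
        simp only [Function.comp_apply, integral_prod_swap] at hadd
        rw [integral_const_mul, hadd]
        ring
    _ ≤ Real.pi * ∫ x, ‖g x‖ ^ 2 ∂volPos := integral_schurMajorant_le hm hg

theorem integrable_exp_neg_mul {a : ℝ} (ha : 0 < a) :
    Integrable (fun s => Real.exp (-a * s)) volPos :=
  integrableOn_exp_mul_Ioi (neg_lt_zero.mpr ha) 0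

theorem integral_exp_neg_mul {a : ℝ} (ha : 0 < a) :
    ∫ s, Real.exp (-a * s) ∂volPos = a⁻¹ := by
  rw [volPos, integral_exp_mul_Ioi (neg_lt_zero.mpr ha)]
  simp

/-- The integrand of the Hilbert form with `1 / (m + x + t)` resolved into the exponentials
`e ^ (-(m + x + t) s)`. -/
def laplaceIntegrand (m : ℝ) (g : ℝ → ℂ) (p : ℝ × ℝ) (s : ℝ) : ℂ :=
  conj (g p.1) * g p.2 * (Real.exp (-(m + p.1 + p.2) * s) : ℂ)

theorem integral_laplaceIntegrand (hm : 0 ≤ m) {x t : ℝ} (hx : 0 < x) (ht : 0 < t) :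
    ∫ s, laplaceIntegrand m g (x, t) s ∂volPos = hilbertIntegrand m g (x, t) := by
  simp only [laplaceIntegrand, hilbertIntegrand]
  rw [integral_const_mul, integral_complex_ofReal, integral_exp_neg_mul (by linarith),
    Complex.ofReal_inv, mul_assoc]

theorem integral_norm_laplaceIntegrand (hm : 0 ≤ m) {x t : ℝ} (hx : 0 < x) (ht : 0 < t) :
    ∫ s, ‖laplaceIntegrand m g (x, t) s‖ ∂volPos = ‖hilbertIntegrand m g (x, t)‖ := by
  simp only [laplaceIntegrand, hilbertIntegrand, norm_mul, norm_inv, Complex.norm_real,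
    Real.norm_of_nonneg (Real.exp_pos _).le]
  rw [integral_const_mul, integral_exp_neg_mul (by linarith),
    Real.norm_of_nonneg (by linarith), mul_assoc]

theorem integrable_laplaceIntegrand (hm : 0 ≤ m) (hg : MemLp g 2 volPos) :
    Integrable (Function.uncurry (laplaceIntegrand m g)) ((volPos.prod volPos).prod volPos) := by
  have hmeas : AEStronglyMeasurable (fun p : ℝ × ℝ => conj (g p.1) * g p.2)
      (volPos.prod volPos) :=
    (Complex.continuous_conj.comp_aestronglyMeasurable hg.1.comp_fst).mul hg.1.comp_snd
  refine (integrable_prod_iff (hmeas.comp_fst.mul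
    (Measurable.aestronglyMeasurable (by fun_prop)))).mpr
    ⟨ae_volPos_prod_of_forall_pos fun x t hx ht => ?_, ?_⟩
  · have hpos : 0 < m + x + t := by linarith
    exact ((integrable_exp_neg_mul hpos).ofReal (𝕜 := ℂ)).const_mul (conj (g x) * g t)
  · exact (integrable_hilbertIntegrand hm hg).norm.congr (ae_volPos_prod_of_forall_pos
      fun x t hx ht => (integral_norm_laplaceIntegrand hm hx ht).symm)

theorem integral_laplaceIntegrand_prod (m : ℝ) (g : ℝ → ℂ) (s : ℝ) :
    ∫ p, laplaceIntegrand m g p s ∂volPos.prod volPos =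
      ((Real.exp (-m * s) * ‖∫ t, g t * (Real.exp (-t * s) : ℂ) ∂volPos‖ ^ 2 : ℝ) : ℂ) := by
  have hsplit (p : ℝ × ℝ) : laplaceIntegrand m g p s = (Real.exp (-m * s) : ℂ) *
      (conj (g p.1 * (Real.exp (-p.1 * s) : ℂ)) * (g p.2 * (Real.exp (-p.2 * s) : ℂ))) := by
    rw [laplaceIntegrand, show -(m + p.1 + p.2) * s = -m * s + (-p.1 * s + -p.2 * s) by ring,
      Real.exp_add, Real.exp_add, map_mul, Complex.conj_ofReal]
    push_cast
    ring
  simp_rw [hsplit]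
  rw [integral_const_mul, integral_prod_mul
    (f := fun x => conj (g x * (Real.exp (-x * s) : ℂ)))
    (g := fun t => g t * (Real.exp (-t * s) : ℂ)), integral_conj, Complex.conj_mul']
  push_cast
  rfl

theorem exists_nonneg_hilbertForm_eq (hm : 0 ≤ m) (hg : MemLp g 2 volPos) :
    ∃ q : ℝ, 0 ≤ q ∧ hilbertForm m g = q := by
  refine ⟨∫ s, Real.exp (-m * s) * ‖∫ t, g t * (Real.exp (-t * s) : ℂ) ∂volPos‖ ^ 2 ∂volPos,
    integral_nonneg fun s => by positivity, ?_⟩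
  calc hilbertForm m g
      = ∫ p, ∫ s, laplaceIntegrand m g p s ∂volPos ∂volPos.prod volPos :=
        integral_congr_ae (ae_volPos_prod_of_forall_pos
          fun x t hx ht => (integral_laplaceIntegrand hm hx ht).symm)
    _ = ∫ s, ∫ p, laplaceIntegrand m g p s ∂volPos.prod volPos ∂volPos :=
        integral_integral_swap (integrable_laplaceIntegrand hm hg)
    _ = _ := by
        simp_rw [integral_laplaceIntegrand_prod]
        exact integral_complex_ofReal

theorem memLp_inv_add {a : ℝ} (ha : 0 < a) :
    MemLp (fun t : ℝ => ((a + t : ℝ) : ℂ)⁻¹) 2 volPos := by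
  refine (memLp_two_iff_integrable_sq_norm
    (Measurable.aestronglyMeasurable (by fun_prop))).mpr ?_
  refine Integrable.congr (integrableOn_add_rpow_Ioi_of_lt (a := -2) (c := 0) (m := a)
    (by norm_num) (by linarith)) (ae_volPos_of_forall_pos fun t ht => ?_)
  simp only
  rw [norm_inv, Complex.norm_of_nonneg (by linarith), add_comm t, Real.rpow_neg (by linarith),
    Real.rpow_two, inv_pow]

theorem integrable_mul_inv_add {f : ℝ → ℂ} (hf : MemLp f 2 volPos) {a : ℝ} (ha : 0 < a) :
    Integrable (fun t : ℝ => f t * ((a + t : ℝ) : ℂ)⁻¹) volPos :=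
  hf.integrable_mul (memLp_inv_add ha)

end HilbertForm

/-! ### Equations with a Hilbert kernel -/

section HilbertEquation

variable {lam m : ℝ} {w : ℝ → ℝ}

theorem norm_ofReal_mul_le {w : ℝ} {z : ℂ} (hw : |w| ≤ 1) : ‖(w : ℂ) * z‖ ≤ ‖z‖ := by
  rw [norm_mul, Complex.norm_real]
  exact mul_le_of_le_one_left (norm_nonneg _) hw

theorem memLp_ofReal_mul {f : ℝ → ℂ} (hw : Measurable w) (hw1 : ∀ x, 0 < x → |w x| ≤ 1)
    (hf : MemLp f 2 volPos) : MemLp (fun x => (w x : ℂ) * f x) 2 volPos :=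
  hf.mono ((Complex.measurable_ofReal.comp hw).aestronglyMeasurable.mul hf.1)
    (ae_volPos_of_forall_pos fun x hx => norm_ofReal_mul_le (hw1 x hx))

theorem integral_sq_norm_eq_neg_mul_hilbertForm {r : ℝ → ℂ}
    (hint : Integrable (hilbertIntegrand m fun x => w x * r x) (volPos.prod volPos))
    (heq : ∀ᵐ x ∂volPos, r x =
      -(lam : ℂ) * (w x * ∫ t, w t * r t * ((m + x + t : ℝ) : ℂ)⁻¹ ∂volPos)) :
    ((∫ x, ‖r x‖ ^ 2 ∂volPos : ℝ) : ℂ) = -lam * hilbertForm m fun x => w x * r x := by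
  rw [hilbertForm, integral_prod _ hint, ← integral_const_mul, ← integral_complex_ofReal]
  refine integral_congr_ae (heq.mono fun x hx => ?_)
  simp only [hilbertIntegrand]
  rw [integral_const_mul, map_mul, Complex.conj_ofReal, Complex.ofReal_pow, ← Complex.conj_mul']
  nth_rewrite 2 [hx]
  ring

/-- Pairing the equation with `r` gives `‖r‖² = -λ Q` for the Hilbert form `Q` of `w r`, whereas
`0 ≤ Q ≤ π ‖r‖²` and `-λ π < 1`. -/
theorem ae_eq_zero_of_hilbert_equation (hlam : -(1 / Real.pi) < lam) (hm : 0 ≤ m)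
    (hw : Measurable w) (hw1 : ∀ x, 0 < x → |w x| ≤ 1) {r : ℝ → ℂ} (hr : MemLp r 2 volPos)
    (heq : ∀ᵐ x ∂volPos, r x =
      -(lam : ℂ) * (w x * ∫ t, w t * r t * ((m + x + t : ℝ) : ℂ)⁻¹ ∂volPos)) :
    r =ᵐ[volPos] 0 := by
  have hwr := memLp_ofReal_mul hw hw1 hr
  have hr2 := (memLp_two_iff_integrable_sq_norm hr.1).mp hr
  obtain ⟨q, hq0, hq⟩ := exists_nonneg_hilbertForm_eq hm hwr
  have hnorm : ∫ x, ‖r x‖ ^ 2 ∂volPos = -lam * q := by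
    have := integral_sq_norm_eq_neg_mul_hilbertForm (integrable_hilbertIntegrand hm hwr) heq
    rw [hq] at this
    exact_mod_cast this
  have hle : q ≤ Real.pi * ∫ x, ‖r x‖ ^ 2 ∂volPos := by
    have hbound := norm_hilbertForm_le hm hwr
    rw [hq, Complex.norm_of_nonneg hq0] at hbound
    refine hbound.trans (mul_le_mul_of_nonneg_left (integral_mono_ae
      ((memLp_two_iff_integrable_sq_norm hwr.1).mp hwr) hr2 ?_) Real.pi_pos.le)
    exact ae_volPos_of_forall_pos fun x hx =>
      pow_le_pow_left₀ (norm_nonneg _) (norm_ofReal_mul_le (hw1 x hx)) 2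
  have hlam' : 0 < 1 + lam * Real.pi := by
    rw [neg_lt, lt_div_iff₀ Real.pi_pos] at hlam
    linarith
  have hnonneg : 0 ≤ ∫ x, ‖r x‖ ^ 2 ∂volPos := integral_nonneg fun x => by positivity
  have hzero : ∫ x, ‖r x‖ ^ 2 ∂volPos = 0 := by
    rcases le_total 0 lam with h | h <;> nlinarith
  refine ((integral_eq_zero_iff_of_nonneg (fun x => by positivity) hr2).mp hzero).mono ?_
  exact fun x hx => by simpa using hx

theorem ae_eq_of_hilbert_equation (hlam : -(1 / Real.pi) < lam) (hm : 0 ≤ m)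
    (hw : Measurable w) (hw1 : ∀ x, 0 < x → |w x| ≤ 1) {f g h : ℝ → ℂ} (hf : MemLp f 2 volPos)
    (hg : MemLp g 2 volPos)
    (hfe : ∀ᵐ x ∂volPos, f x =
      h x - lam * (w x * ∫ t, w t * f t * ((m + x + t : ℝ) : ℂ)⁻¹ ∂volPos))
    (hge : ∀ᵐ x ∂volPos, g x =
      h x - lam * (w x * ∫ t, w t * g t * ((m + x + t : ℝ) : ℂ)⁻¹ ∂volPos)) :
    f =ᵐ[volPos] g := by
  refine (ae_eq_zero_of_hilbert_equation hlam hm hw hw1 (hf.sub hg) ?_).mono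
    fun x hx => sub_eq_zero.mp hx
  filter_upwards [hfe, hge, ae_volPos_of_forall_pos fun _ h => h] with x hfx hgx hx
  have hint {u : ℝ → ℂ} (hu : MemLp u 2 volPos) :=
    integrable_mul_inv_add (memLp_ofReal_mul hw hw1 hu) (add_pos_of_nonneg_of_pos hm hx)
  have hsub : ∫ t, w t * (f - g) t * ((m + x + t : ℝ) : ℂ)⁻¹ ∂volPos =
      ∫ t, w t * f t * ((m + x + t : ℝ) : ℂ)⁻¹ ∂volPos -
        ∫ t, w t * g t * ((m + x + t : ℝ) : ℂ)⁻¹ ∂volPos := by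
    rw [← integral_sub (hint hf) (hint hg)]
    simp only [Pi.sub_apply, mul_sub, sub_mul]
  rw [hsub, Pi.sub_apply, hfx, hgx]
  ring

end HilbertEquation

/-! ### The rescaled equation -/

section Rescaled

variable {lam : ℝ} {c d : ℂ} {f g : ℝ → ℂ}

theorem rescaledIntegrand_eq_mul_inv (f : ℝ → ℂ) (x t : ℝ) :
    rescaledIntegrand f x t = f t * (1 + (t : ℂ) + (x : ℂ))⁻¹ := by
  rw [rescaledIntegrand, div_eq_mul_inv]
  push_cast
  rfl

theorem integral_rescaledIntegrand (f : ℝ → ℂ) (x : ℝ) :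
    ∫ t, rescaledIntegrand f x t ∂volPos = stieltjes f x := by
  simp only [rescaledIntegrand_eq_mul_inv, stieltjes]

theorem rescaledRHS_eq_hilbert (lam : ℝ) (c : ℂ) (f : ℝ → ℂ) (x : ℝ) :
    rescaledRHS lam c f x = c / ((1 + x : ℝ) : ℂ) - lam *
      (((1 : ℝ) : ℂ) * ∫ t, ((1 : ℝ) : ℂ) * f t * ((1 + x + t : ℝ) : ℂ)⁻¹ ∂volPos) := by
  simp only [rescaledRHS, rescaledIntegrand, Complex.ofReal_one, one_mul, div_eq_mul_inv,
    add_right_comm]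

theorem ae_eq_of_eq_rescaledRHS (hlam : -(1 / Real.pi) < lam) (hf : MemLp f 2 volPos)
    (hg : MemLp g 2 volPos) (hfe : ∀ᵐ x ∂volPos, f x = rescaledRHS lam c f x)
    (hge : ∀ᵐ x ∂volPos, g x = rescaledRHS lam c g x) : f =ᵐ[volPos] g := by
  simp only [rescaledRHS_eq_hilbert] at hfe hge
  exact ae_eq_of_hilbert_equation hlam zero_le_one (w := fun _ => 1) measurable_const
    (fun _ _ => abs_one.le) hf hg hfe hge

theorem rescaledRHS_congr_ae (hfg : f =ᵐ[volPos] g) (x : ℝ) :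
    rescaledRHS lam c f x = rescaledRHS lam c g x := by
  rw [rescaledRHS, rescaledRHS, integral_congr_ae (hfg.mono fun t ht => ?_)]
  simp only [rescaledIntegrand, ht]

theorem eq_of_eq_rescaledRHS (hlam : -(1 / Real.pi) < lam) (hf : MemLp f 2 volPos)
    (hg : MemLp g 2 volPos) (hfe : ∀ x, 0 ≤ x → f x = rescaledRHS lam c f x)
    (hge : ∀ x, 0 ≤ x → g x = rescaledRHS lam c g x) {x : ℝ} (hx : 0 ≤ x) : f x = g x := by
  rw [hfe x hx, hge x hx]
  exact rescaledRHS_congr_ae (ae_eq_of_eq_rescaledRHS hlam hf hg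
    (ae_volPos_of_forall_pos fun y hy => hfe y hy.le)
    (ae_volPos_of_forall_pos fun y hy => hge y hy.le)) x

theorem rescaledRHS_const_mul (lam : ℝ) (a c : ℂ) (f : ℝ → ℂ) (x : ℝ) :
    rescaledRHS lam (a * c) (fun t => a * f t) x = a * rescaledRHS lam c f x := by
  simp only [rescaledRHS, rescaledIntegrand, mul_div_assoc, integral_const_mul]
  ring

theorem SolvesRescaled.const_ne_zero (hlam : -(1 / Real.pi) < lam) (hf : MemLp f 2 volPos)
    (h : SolvesRescaled lam c f) : c ≠ 0 := by
  rintro rfl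
  have hzero : f 0 = 0 := eq_of_eq_rescaledRHS hlam hf MemLp.zero' (fun x hx => (h.1 x hx).2)
    (fun x _ => by simp [rescaledRHS, rescaledIntegrand]) le_rfl
  exact one_ne_zero (h.2.symm.trans hzero)

theorem SolvesRescaled.unique (hlam : -(1 / Real.pi) < lam) (hf : MemLp f 2 volPos)
    (hg : MemLp g 2 volPos) (hfs : SolvesRescaled lam c f) (hgs : SolvesRescaled lam d g) :
    c = d ∧ ∀ x, 0 ≤ x → f x = g x := by
  have hmul : ∀ x, 0 ≤ x → d * f x = c * g x := fun x hx =>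
    eq_of_eq_rescaledRHS hlam (hf.const_mul d) (hg.const_mul c) (c := d * c)
      (fun y hy => by rw [rescaledRHS_const_mul, ← (hfs.1 y hy).2])
      (fun y hy => by rw [mul_comm d, rescaledRHS_const_mul, ← (hgs.1 y hy).2]) hx
  have hcd : c = d := by simpa [hfs.2, hgs.2, eq_comm] using hmul 0 le_rfl
  refine ⟨hcd, fun x hx => mul_left_cancel₀ (hgs.const_ne_zero hlam hg) ?_⟩
  rw [hmul x hx, hcd]

theorem SolvesRescaled.conj (h : SolvesRescaled lam c f) :
    SolvesRescaled lam (conj c) fun x => conj (f x) := by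
  have hconj (x : ℝ) : rescaledIntegrand (fun t => conj (f t)) x =
      fun t => conj (rescaledIntegrand f x t) := by
    ext t
    simp only [rescaledIntegrand, map_div₀, Complex.conj_ofReal]
  refine ⟨fun x hx => ⟨?_, ?_⟩, by simp only [h.2, map_one]⟩
  · rw [hconj]
    exact (Complex.conjCLE.toContinuousLinearMap.integrable_comp (h.1 x hx).1)
  · change conj (f x) = _
    rw [(h.1 x hx).2]
    simp only [rescaledRHS, hconj, integral_conj, map_sub, map_div₀, map_mul, Complex.conj_ofReal]

theorem SolvesRescaled.im_eq_zero (hlam : -(1 / Real.pi) < lam) (hf : MemLp f 2 volPos)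
    (h : SolvesRescaled lam c f) : c.im = 0 ∧ ∀ x, 0 ≤ x → (f x).im = 0 := by
  obtain ⟨hc, hfc⟩ := h.conj.unique hlam hf.star hf h
  exact ⟨Complex.conj_eq_iff_im.mp hc, fun x hx => Complex.conj_eq_iff_im.mp (hfc x hx)⟩

end Rescaled

/-! ### The Fredholm equation -/

section Fredholm

variable {lam mu : ℝ}

/-- The weight `x / (μ² + x)` that symmetrises the kernel of the Fredholm equation. -/
def fredWeight (mu x : ℝ) : ℝ :=
  x / (mu ^ 2 + x)

theorem measurable_fredWeight (mu : ℝ) : Measurable (fredWeight mu) :=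
  measurable_id.div (measurable_const.add measurable_id)

theorem abs_fredWeight_le_one (mu : ℝ) {x : ℝ} (hx : 0 < x) : |fredWeight mu x| ≤ 1 := by
  rw [fredWeight, abs_of_nonneg (by positivity)]
  exact div_le_one_of_le₀ (by linarith [sq_nonneg mu]) (by positivity)

theorem fredIntegrand_eq_fredWeight_mul (mu : ℝ) (K : ℝ → ℂ) (x : ℝ) {t : ℝ} (ht : 0 < t) :
    fredIntegrand mu K x t =
      (fredWeight mu t : ℂ) * symmetrised mu K t * ((mu ^ 2 + x + t : ℝ) : ℂ)⁻¹ := by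
  have hweight : fredWeight mu t * (t * (mu ^ 2 + t))⁻¹ = ((t + mu ^ 2) ^ 2)⁻¹ := by
    rw [fredWeight, add_comm t]
    field_simp
  rw [fredIntegrand, symmetrised, show t + mu ^ 2 + x = mu ^ 2 + x + t by ring,
    Complex.ofReal_mul, div_eq_mul_inv, mul_inv, ← Complex.ofReal_inv ((t + mu ^ 2) ^ 2), ← hweight]
  push_cast
  ring

theorem symmetrised_eq_of_eq_fredRHS {K : ℝ → ℂ} {x : ℝ} (hx : 0 < x)
    (h : K x = fredRHS lam mu K x) :
    symmetrised mu K x = ((mu ^ 2 + x : ℝ) : ℂ)⁻¹ - lam * (fredWeight mu x *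
      ∫ t, (fredWeight mu t : ℂ) * symmetrised mu K t *
        ((mu ^ 2 + x + t : ℝ) : ℂ)⁻¹ ∂volPos) := by
  rw [← integral_congr_ae (ae_volPos_of_forall_pos fun t ht =>
    fredIntegrand_eq_fredWeight_mul mu K x ht), symmetrised, h, fredRHS, fredWeight]
  have hx0 : (x : ℂ) ≠ 0 := by exact_mod_cast hx.ne'
  have hmx : ((mu ^ 2 + x : ℝ) : ℂ) ≠ 0 := by exact_mod_cast (by positivity : mu ^ 2 + x ≠ 0)
  rw [Complex.ofReal_mul, Complex.ofReal_div]
  field_simp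

theorem ae_eq_of_eq_fredRHS (hlam : -(1 / Real.pi) < lam) {K L : ℝ → ℂ}
    (hK : MemLp (symmetrised mu K) 2 volPos) (hL : MemLp (symmetrised mu L) 2 volPos)
    (hKe : ∀ᵐ x ∂volPos, K x = fredRHS lam mu K x)
    (hLe : ∀ᵐ x ∂volPos, L x = fredRHS lam mu L x) : K =ᵐ[volPos] L := by
  have hpos : ∀ᵐ x ∂volPos, 0 < x := ae_volPos_of_forall_pos fun _ h => h
  have hsymm := ae_eq_of_hilbert_equation hlam (sq_nonneg mu) (measurable_fredWeight mu)
    (fun x hx => abs_fredWeight_le_one mu hx) hK hL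
    (hKe.mp (hpos.mono fun x hx => symmetrised_eq_of_eq_fredRHS hx))
    (hLe.mp (hpos.mono fun x hx => symmetrised_eq_of_eq_fredRHS hx))
  filter_upwards [hsymm, hpos] with x hxs hx
  have hne : x * (mu ^ 2 + x) ≠ 0 := by positivity
  exact (div_left_inj' (by exact_mod_cast hne)).mp hxs

end Fredholm

/-! ### From `φ` to `J` -/

section Transport

variable {lam mu : ℝ}

/-- The function `x (1 + x) φ(x)`, which is `J` at `μ = 1`. -/
def unitJ (phi : ℝ → ℂ) (x : ℝ) : ℂ :=
  ((x * (1 + x) : ℝ) : ℂ) * phi x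

/-- The dilation `x ↦ μ² J(x / μ²)`, which turns solutions of the Fredholm equation for `μ = 1` into
solutions of the one for `μ`. -/
def dilate (mu : ℝ) (J : ℝ → ℂ) (x : ℝ) : ℂ :=
  ((mu ^ 2 : ℝ) : ℂ) * J (x / mu ^ 2)

theorem map_div_volPos {a : ℝ} (ha : 0 < a) :
    volPos.map (· / a) = ENNReal.ofReal a • volPos := by
  have hpre : (· / a) ⁻¹' Set.Ioi 0 = Set.Ioi (0 : ℝ) := by
    ext t
    simp [div_pos_iff_of_pos_right ha]
  have hmap := Real.map_volume_mul_right (inv_ne_zero ha.ne')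
  simp only [← div_eq_mul_inv, inv_inv, abs_of_pos ha] at hmap
  rw [volPos, ← Measure.restrict_smul, ← hmap,
    Measure.restrict_map (by fun_prop) measurableSet_Ioi, hpre]

theorem measurableEmbedding_div {a : ℝ} (ha : a ≠ 0) :
    MeasurableEmbedding fun t : ℝ => t / a := by
  simpa only [div_eq_mul_inv] using measurableEmbedding_mulRight₀ (inv_ne_zero ha)

theorem integrable_volPos_comp_div {a : ℝ} (ha : 0 < a) {f : ℝ → ℂ} (hf : Integrable f volPos) :
    Integrable (fun t => f (t / a)) volPos := by
  refine (measurableEmbedding_div ha.ne').integrable_map_iff.mp ?_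
  rw [map_div_volPos ha]
  exact hf.smul_measure ENNReal.ofReal_ne_top

theorem integral_volPos_comp_div {a : ℝ} (ha : 0 < a) (f : ℝ → ℂ) :
    ∫ t, f (t / a) ∂volPos = a * ∫ t, f t ∂volPos := by
  rw [← (measurableEmbedding_div ha.ne').integral_map, map_div_volPos ha, integral_smul_measure,
    ENNReal.toReal_ofReal ha.le, Complex.real_smul]

theorem memLp_volPos_comp_div {a : ℝ} (ha : 0 < a) {f : ℝ → ℂ} (hf : MemLp f 2 volPos) :
    MemLp (fun t => f (t / a)) 2 volPos := by
  refine (measurableEmbedding_div ha.ne').memLp_map_measure_iff.mp ?_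
  rw [map_div_volPos ha]
  exact hf.smul_measure ENNReal.ofReal_ne_top

theorem fredIntegrand_dilate (hmu : mu ≠ 0) (J : ℝ → ℂ) (x t : ℝ) :
    fredIntegrand mu (dilate mu J) x t =
      ((mu ^ 4 : ℝ) : ℂ)⁻¹ * fredIntegrand 1 J (x / mu ^ 2) (t / mu ^ 2) := by
  have hden : (t + mu ^ 2) ^ 2 * (t + mu ^ 2 + x) = mu ^ 2 * mu ^ 4 *
      ((t / mu ^ 2 + 1 ^ 2) ^ 2 * (t / mu ^ 2 + 1 ^ 2 + x / mu ^ 2)) := by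
    field_simp
  have hmu2 : ((mu ^ 2 : ℝ) : ℂ) ≠ 0 := by exact_mod_cast pow_ne_zero 2 hmu
  rw [fredIntegrand, fredIntegrand, dilate, hden, mul_assoc, Complex.ofReal_mul,
    mul_div_mul_left _ _ hmu2, Complex.ofReal_mul, div_mul_eq_div_div_swap, div_eq_inv_mul]

theorem SolvesFredholm.dilate {J : ℝ → ℂ} (hmu : mu ≠ 0) (h : SolvesFredholm lam 1 J) :
    SolvesFredholm lam mu (dilate mu J) := by
  intro x hx
  have hmu2 : 0 < mu ^ 2 := by positivity
  have hmuC : (mu : ℂ) ≠ 0 := by exact_mod_cast hmu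
  obtain ⟨hint, heq⟩ := h (x / mu ^ 2) (by positivity)
  refine ⟨?_, ?_⟩
  · refine Integrable.congr ((integrable_volPos_comp_div hmu2 hint).const_mul _)
      (Eventually.of_forall fun t => (fredIntegrand_dilate hmu J x t).symm)
  · simp only [fredRHS, fredIntegrand_dilate hmu] at heq ⊢
    rw [integral_const_mul, integral_volPos_comp_div hmu2 (fredIntegrand 1 J (x / mu ^ 2)),
      SelfDualPhi4.dilate, heq]
    push_cast
    field_simp

theorem symmetrised_dilate (hmu : mu ≠ 0) (J : ℝ → ℂ) (x : ℝ) :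
    symmetrised mu (dilate mu J) x =
      ((mu ^ 2 : ℝ) : ℂ)⁻¹ * symmetrised 1 J (x / mu ^ 2) := by
  have hden : x * (mu ^ 2 + x) = mu ^ 2 * (mu ^ 2 * (x / mu ^ 2 * (1 ^ 2 + x / mu ^ 2))) := by
    field_simp
  have hmu2 : ((mu ^ 2 : ℝ) : ℂ) ≠ 0 := by exact_mod_cast pow_ne_zero 2 hmu
  rw [symmetrised, symmetrised, dilate, hden, Complex.ofReal_mul, mul_div_mul_left _ _ hmu2,
    Complex.ofReal_mul, div_mul_eq_div_div_swap, div_eq_inv_mul]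

theorem symmetrised_one_unitJ (phi : ℝ → ℂ) {x : ℝ} (hx : 0 < x) :
    symmetrised 1 (unitJ phi) x = phi x := by
  have hne : x * (1 + x) ≠ 0 := by positivity
  rw [symmetrised, unitJ, one_pow, mul_div_cancel_left₀ _ (by exact_mod_cast hne)]

theorem memLp_symmetrised_dilate_unitJ {phi : ℝ → ℂ} (hmu : mu ≠ 0) (hphi : MemLp phi 2 volPos) :
    MemLp (symmetrised mu (dilate mu (unitJ phi))) 2 volPos := by
  have hmu2 : 0 < mu ^ 2 := by positivity
  refine ((memLp_volPos_comp_div hmu2 hphi).const_mul ((mu ^ 2 : ℝ) : ℂ)⁻¹).ae_eq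
    (ae_volPos_of_forall_pos fun x hx => ?_)
  rw [symmetrised_dilate hmu, symmetrised_one_unitJ _ (div_pos hx hmu2)]

theorem mul_fredIntegrand_one_unitJ (phi : ℝ → ℂ) {x t : ℝ} (hx : 0 ≤ x) (ht : 0 ≤ t) :
    (x : ℂ) * fredIntegrand 1 (unitJ phi) x t =
      ((1 + x : ℝ) : ℂ) * rescaledIntegrand phi x t - rescaledIntegrand phi 0 t := by
  have ht1 : 1 + (t : ℂ) ≠ 0 := one_add_ofReal_ne_zero ht
  have hxt : 1 + (t : ℂ) + x ≠ 0 :=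
    one_add_add_ne_zero (by rw [Complex.ofReal_re]; linarith) ht
  simp only [fredIntegrand, unitJ, rescaledIntegrand]
  push_cast
  rw [one_pow, add_comm (t : ℂ) 1, add_zero]
  field_simp
  ring

theorem integrable_fredIntegrand_one_unitJ {phi : ℝ → ℂ}
    (hphi : Integrable (fun t : ℝ => phi t * (1 + (t : ℂ))⁻¹) volPos) {x : ℝ} (hx : 0 ≤ x) :
    Integrable (fredIntegrand 1 (unitJ phi) x) volPos := by
  refine Integrable.congr (integrable_mul_of_norm_le_inv_one_add (K := 1)
    (k := fun t : ℝ => ((t / ((1 + t) * (1 + t + x)) : ℝ) : ℂ)) hphi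
    (Measurable.aestronglyMeasurable (by fun_prop)) fun t ht => ?_)
    (ae_volPos_of_forall_pos fun t ht => ?_)
  · rw [Complex.norm_of_nonneg (by positivity), one_mul, div_le_iff₀ (by positivity),
      inv_mul_cancel_left₀ (by positivity)]
    linarith
  · have hker : t / ((1 + t) * (1 + t + x)) =
        t * (1 + t) / ((t + 1 ^ 2) ^ 2 * (t + 1 ^ 2 + x)) := by
      rw [one_pow, add_comm t 1]
      field_simp
    simp only [fredIntegrand, unitJ]
    rw [hker, Complex.ofReal_div]
    ring

theorem SolvesRescaled.solvesFredholm_one_unitJ {c : ℂ} {phi : ℝ → ℂ}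
    (h : SolvesRescaled lam c phi) : SolvesFredholm lam 1 (unitJ phi) := by
  intro x hx
  obtain ⟨hint0, heq0⟩ := h.1 0 le_rfl
  obtain ⟨hint, heq⟩ := h.1 x hx
  refine ⟨integrable_fredIntegrand_one_unitJ ?_ hx, ?_⟩
  · simpa only [funext (rescaledIntegrand_eq_mul_inv phi 0), Complex.ofReal_zero, add_zero]
      using hint0
  have hx1 : ((1 + x : ℝ) : ℂ) ≠ 0 := by exact_mod_cast (by positivity : 1 + x ≠ 0)
  have hsplit : (x : ℂ) * ∫ t, fredIntegrand 1 (unitJ phi) x t ∂volPos =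
      ((1 + x : ℝ) : ℂ) * ∫ t, rescaledIntegrand phi x t ∂volPos -
        ∫ t, rescaledIntegrand phi 0 t ∂volPos := by
    rw [← integral_const_mul, ← integral_const_mul, ← integral_sub (hint.const_mul _) hint0]
    exact integral_congr_ae (ae_volPos_of_forall_pos fun t ht =>
      mul_fredIntegrand_one_unitJ phi hx ht.le)
  rw [h.2, rescaledRHS, add_zero, Complex.ofReal_one, div_one] at heq0
  rw [rescaledRHS, eq_sub_iff_add_eq, eq_div_iff hx1] at heq
  rw [fredRHS, unitJ, Complex.ofReal_mul]
  linear_combination (x : ℂ) * (heq - heq0) + lam * x * hsplit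

end Transport

/-! ### The parameter `α_λ` -/

section Parameter

variable {lam : ℝ}

theorem neg_one_lt_mul_pi (hlam : -(1 / Real.pi) < lam) : -1 < lam * Real.pi :=
  (div_lt_iff₀ Real.pi_pos).mp (by rwa [neg_div])

theorem alphaParam_of_le (h : lam ≤ 1 / Real.pi) :
    alphaParam lam = ((Real.arcsin (lam * Real.pi) / Real.pi : ℝ) : ℂ) := by
  rw [alphaParam, if_pos h]

theorem alphaParam_zero : alphaParam 0 = 0 := by
  simp [alphaParam_of_le (one_div_pos.mpr Real.pi_pos).le]

theorem sin_alphaParam (hlam : -(1 / Real.pi) < lam) :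
    Complex.sin (alphaParam lam * (Real.pi : ℂ)) = ((lam * Real.pi : ℝ) : ℂ) := by
  rcases le_total lam (1 / Real.pi) with hle | hge
  · rw [alphaParam_of_le hle, ← Complex.ofReal_mul, div_mul_cancel₀ _ Real.pi_ne_zero,
      ← Complex.ofReal_sin, Real.sin_arcsin (neg_one_lt_mul_pi hlam).le
        ((le_div_iff₀ Real.pi_pos).mp hle)]
  · have hpi : (Real.pi : ℂ) ≠ 0 := by exact_mod_cast Real.pi_ne_zero
    have hangle : (1 / 2 + Complex.I * ((Real.arcosh (lam * Real.pi) / Real.pi : ℝ) : ℂ)) *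
        Real.pi = (Real.arcosh (lam * Real.pi) : ℂ) * Complex.I + Real.pi / 2 := by
      push_cast
      field_simp
      ring
    rw [alphaParam_of_ge hge, hangle, Complex.sin_add_pi_div_two, Complex.cos_mul_I,
      ← Complex.ofReal_cosh, Real.cosh_arcosh ((div_le_iff₀ Real.pi_pos).mp hge)]

theorem sin_alphaParam_mul_pi_div_pi (hlam : -(1 / Real.pi) < lam) :
    Complex.sin (alphaParam lam * (Real.pi : ℂ)) / Real.pi = lam := by
  rw [sin_alphaParam hlam, Complex.ofReal_mul,
    mul_div_cancel_right₀ _ (by exact_mod_cast Real.pi_ne_zero)]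

theorem re_alphaParam_mem_Ioo (hlam : -(1 / Real.pi) < lam) :
    (alphaParam lam).re ∈ Set.Ioo (-(1 / 2)) 1 := by
  rcases le_total lam (1 / Real.pi) with hle | hge
  · rw [alphaParam_of_le hle, Complex.ofReal_re, Set.mem_Ioo, lt_div_iff₀ Real.pi_pos,
      div_lt_iff₀ Real.pi_pos]
    have hlower := Real.neg_pi_div_two_lt_arcsin.mpr (neg_one_lt_mul_pi hlam)
    have hupper := Real.arcsin_le_pi_div_two (lam * Real.pi)
    constructor <;> linarith [Real.pi_pos]
  · rw [alphaParam_of_ge hge]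
    norm_num

theorem re_alphaParam_mem_Ioo_neg_one_one (hlam : -(1 / Real.pi) < lam) :
    (alphaParam lam).re ∈ Set.Ioo (-1) 1 :=
  Set.Ioo_subset_Ioo_left (by norm_num) (re_alphaParam_mem_Ioo hlam)

theorem cParam_eq_gaussPhiConst (hlam : -(1 / Real.pi) < lam) :
    cParam lam = gaussPhiConst (alphaParam lam) := by
  rcases eq_or_ne lam 0 with rfl | hlam0
  · simp [cParam, gaussPhiConst, alphaParam_zero]
  have hmul : gaussPhiConst (alphaParam lam) * (alphaParam lam * (1 - alphaParam lam)) = lam := by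
    rw [gaussPhiConst_mul (re_alphaParam_mem_Ioo hlam).2, sin_alphaParam_mul_pi_div_pi hlam]
  have hne : alphaParam lam * (1 - alphaParam lam) ≠ 0 := fun h =>
    hlam0 (by exact_mod_cast (hmul.symm.trans (by rw [h, mul_zero]) : (lam : ℂ) = 0))
  rw [cParam, if_neg hlam0, ← hmul, mul_div_cancel_right₀ _ hne]

end Parameter

/-! ### The solutions `φ` and `J` -/

section Solutions

variable {lam mu : ℝ}

theorem solPhi_eq_gaussPhi (lam : ℝ) : solPhi lam = fun x : ℝ => gaussPhi (alphaParam lam) x := by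
  ext x
  rw [solPhi, gaussPhi, Complex.ofReal_neg]

theorem memLp_solPhi (hlam : -(1 / Real.pi) < lam) : MemLp (solPhi lam) 2 volPos :=
  solPhi_eq_gaussPhi lam ▸ memLp_gaussPhi (re_alphaParam_mem_Ioo hlam)

theorem solvesRescaled_solPhi (hlam : -(1 / Real.pi) < lam) :
    SolvesRescaled lam (cParam lam) (solPhi lam) := by
  have hal := re_alphaParam_mem_Ioo_neg_one_one hlam
  rw [solPhi_eq_gaussPhi]
  refine ⟨fun x hx => ?_, by simpa only [Complex.ofReal_zero] using gaussPhi_zero hal⟩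
  have hre : -1 < (x : ℂ).re := by rw [Complex.ofReal_re]; linarith
  constructor
  · rw [funext (rescaledIntegrand_eq_mul_inv _ x)]
    exact integrable_stieltjes (integrable_gaussPhi_mul_inv hal) hre
  · rw [rescaledRHS, integral_rescaledIntegrand, cParam_eq_gaussPhiConst hlam, eq_sub_iff_add_eq,
      ← sin_alphaParam_mul_pi_div_pi hlam, gaussPhi_add_stieltjes hal hre, div_eq_mul_inv]
    push_cast
    rfl

theorem solJ_eq (hlam : -(1 / Real.pi) < lam) (mu : ℝ) {x : ℝ} (hx : 0 ≤ x) :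
    solJ lam mu x = ((x * (1 + x / mu ^ 2) : ℝ) : ℂ) * solPhi lam (x / mu ^ 2) := by
  have hmem : -((x / mu ^ 2 : ℝ) : ℂ) ∈ cutPlane := neg_ofReal_mem_cutPlane (by positivity)
  have heuler := (isGaussContinuation_one_sub_mul_hyp2F1
    (re_alphaParam_mem_Ioo_neg_one_one hlam)).eqOn_hyp2F1 hmem
  rw [solJ, solPhi, Complex.ofReal_neg, ← heuler]
  push_cast
  ring

theorem solJ_eq_dilate_unitJ (hlam : -(1 / Real.pi) < lam) (hmu : mu ≠ 0) {x : ℝ} (hx : 0 ≤ x) :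
    solJ lam mu x = dilate mu (unitJ (solPhi lam)) x := by
  rw [solJ_eq hlam mu hx, dilate, unitJ, ← mul_assoc, ← Complex.ofReal_mul]
  congr 2
  field_simp

theorem im_solJ_eq_zero (hlam : -(1 / Real.pi) < lam) (mu : ℝ) {x : ℝ} (hx : 0 ≤ x) :
    (solJ lam mu x).im = 0 := by
  rw [solJ_eq hlam mu hx, Complex.im_ofReal_mul,
    ((solvesRescaled_solPhi hlam).im_eq_zero hlam (memLp_solPhi hlam)).2 _ (by positivity),
    mul_zero]

theorem SolvesFredholm.congr {J K : ℝ → ℂ} (h : SolvesFredholm lam mu J)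
    (hJK : ∀ x, 0 ≤ x → J x = K x) : SolvesFredholm lam mu K := by
  intro x hx
  have hae : fredIntegrand mu J x =ᵐ[volPos] fredIntegrand mu K x :=
    ae_volPos_of_forall_pos fun t ht => by rw [fredIntegrand, fredIntegrand, hJK t ht.le]
  refine ⟨(h x hx).1.congr hae, ?_⟩
  rw [← hJK x hx, (h x hx).2, fredRHS, fredRHS, integral_congr_ae hae]

theorem solvesFredholm_solJ (hlam : -(1 / Real.pi) < lam) (hmu : mu ≠ 0) :
    SolvesFredholm lam mu (solJ lam mu) :=
  ((solvesRescaled_solPhi hlam).solvesFredholm_one_unitJ.dilate hmu).congr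
    fun _ hx => (solJ_eq_dilate_unitJ hlam hmu hx).symm

theorem memLp_symmetrised_solJ (hlam : -(1 / Real.pi) < lam) (hmu : mu ≠ 0) :
    MemLp (symmetrised mu (solJ lam mu)) 2 volPos :=
  (memLp_symmetrised_dilate_unitJ hmu (memLp_solPhi hlam)).ae_eq <|
    ae_volPos_of_forall_pos fun x hx => by
      rw [symmetrised, symmetrised, solJ_eq_dilate_unitJ hlam hmu hx.le]

end Solutions

end SelfDualPhi4

end

theorem mainTheorem1 (lam mu : ℝ) (hlam : -(1 / Real.pi) < lam) (hmu : 0 < mu) :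
    -- the parameter
    Complex.sin (SelfDualPhi4.alphaParam lam * (Real.pi : ℂ)) = ((lam * Real.pi : ℝ) : ℂ) ∧
    -- `J` and `φ` are real-valued on the half-line, and so is the constant
    (∀ x : ℝ, 0 ≤ x → (SelfDualPhi4.solJ lam mu x).im = 0) ∧
    (∀ x : ℝ, 0 ≤ x → (SelfDualPhi4.solPhi lam x).im = 0) ∧
    (SelfDualPhi4.cParam lam).im = 0 ∧
    -- `J` solves the Fredholm equation
    SelfDualPhi4.SolvesFredholm lam mu (SelfDualPhi4.solJ lam mu) ∧
    -- `J` and `φ` correspond to each other under the rescaling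
    (∀ x : ℝ, 0 ≤ x → SelfDualPhi4.solJ lam mu x =
      ((x * (1 + x / mu ^ 2) : ℝ) : ℂ) * SelfDualPhi4.solPhi lam (x / mu ^ 2)) ∧
    -- `φ` solves the rescaled equation with the constant `c_λ`
    SelfDualPhi4.SolvesRescaled lam (SelfDualPhi4.cParam lam) (SelfDualPhi4.solPhi lam) ∧
    -- both solutions lie in the `L²` class
    MeasureTheory.MemLp (SelfDualPhi4.symmetrised mu (SelfDualPhi4.solJ lam mu)) 2
      SelfDualPhi4.volPos ∧
    MeasureTheory.MemLp (SelfDualPhi4.solPhi lam) 2 SelfDualPhi4.volPos ∧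
    -- uniqueness for the Fredholm equation
    (∀ K : ℝ → ℂ,
      MeasureTheory.MemLp (SelfDualPhi4.symmetrised mu K) 2 SelfDualPhi4.volPos →
      (∀ᵐ x ∂SelfDualPhi4.volPos, K x = SelfDualPhi4.fredRHS lam mu K x) →
      ∀ᵐ x ∂SelfDualPhi4.volPos, K x = SelfDualPhi4.solJ lam mu x) ∧
    -- uniqueness for the rescaled equation with the constant `c_λ`
    (∀ psi : ℝ → ℂ, MeasureTheory.MemLp psi 2 SelfDualPhi4.volPos →
      (∀ᵐ x ∂SelfDualPhi4.volPos,
        psi x = SelfDualPhi4.rescaledRHS lam (SelfDualPhi4.cParam lam) psi x) →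
      ∀ᵐ x ∂SelfDualPhi4.volPos, psi x = SelfDualPhi4.solPhi lam x) ∧
    -- the normalisation at `0` determines the constant as well
    (∀ (c : ℂ) (psi : ℝ → ℂ), MeasureTheory.MemLp psi 2 SelfDualPhi4.volPos →
      SelfDualPhi4.SolvesRescaled lam c psi →
      c = SelfDualPhi4.cParam lam ∧ ∀ x : ℝ, 0 ≤ x → psi x = SelfDualPhi4.solPhi lam x) := by
  open SelfDualPhi4 in
  have hmu0 := hmu.ne'
  have hphi := solvesRescaled_solPhi hlam
  have hphiL2 := memLp_solPhi hlam
  have hJ := solvesFredholm_solJ hlam hmu0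
  have hJL2 := memLp_symmetrised_solJ hlam hmu0
  obtain ⟨him_c, him_phi⟩ := hphi.im_eq_zero hlam hphiL2
  exact ⟨sin_alphaParam hlam, fun x => im_solJ_eq_zero hlam mu, him_phi, him_c, hJ,
    fun x => solJ_eq hlam mu, hphi, hJL2, hphiL2,
    fun K hK hKe => ae_eq_of_eq_fredRHS hlam hK hJL2 hKe
      (ae_volPos_of_forall_pos fun x hx => (hJ x hx.le).2),
    fun psi hpsi hpsie => ae_eq_of_eq_rescaledRHS hlam hpsi hphiL2 hpsie
      (ae_volPos_of_forall_pos fun x hx => (hphi.1 x hx.le).2),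
    fun c psi hpsi h => h.unique hlam hpsi hphiL2 hphi⟩
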